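/- Let $n \ge 8$ and $s$ be integers with $s^2 \equiv 1 \pmod n$ and $s \not\equiv \pm 1 \pmod n$, and let $$G_{n,s} = C_n \rtimes_s C_2 = \langle x, y \mid x^2 = y^n = 1,\ yx = xy^s \rangle .$$ A sequence over a finite group $G$ is a finite unordered list of elements of $G$ with repetition allowed; its subsequences are its sub-multisets, $\boldsymbol{\cdot}$ denotes concatenation, and $g^{[k]}$ is the sequence consisting of $k$ copies of $g$. A sequence $T$ over $G$ is a short product-one sequence if $1 \le |T| \le \exp(G)$ and the terms of $T$ can be ordered so that their product is $1$. Let $\eta(G)$ be the smallest $\ell > 0$ such that every sequence over $G$ of length at least $\ell$ has a short product-one subsequence. Then $\eta(G_{n,s}) = n+1$. Moreover, a sequence $S$ over $G_{n,s}$ of length $|S| = n$ has no short product-one subsequence if and only if there exist $\alpha, \beta \in G_{n,s}$ such that $G_{n,s} \simeq \langle \alpha, \beta \mid \alpha^2 = \beta^n = 1,\ \beta\alpha = \alpha\beta^s \rangle$ (that is, $x \mapsto \alpha$, $y \mapsto \beta$ defines an automorphism of $G_{n,s}$) and $$S = \beta^{[n-1]} \boldsymbol{\cdot} (\alpha\beta^t)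 \quad \text{for some integer } 0 \le t \le n-1 .$$ -/

import Mathlib

/-! Sequences over a group are finite unordered lists of terms with repetition, that is, multisets;
concatenation is the sum of multisets, `T` is a subsequence of `S` when `T ≤ S`, and the length is
`Multiset.card`. -/

namespace ZeroSum

section Sequences

variable {G : Type*} [Group G]

/-- The set `π(S)` of all products of the terms of `S`, each term used with its multiplicity, taken
in an arbitrary order. -/
def products (S : Multiset G) : Set G :=
  {g | ∃ l : List G, (l : Multiset G) = S ∧ l.prod = g}

/-- `S` is a product-one sequence: its terms multiply to `1` in some order. -/
def IsProductOne (S : Multiset G) : Prop :=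
  1 ∈ products S

/-- `S` is a short product-one sequence: product-one with `1 ≤ |S| ≤ exp(G)`. -/
def IsShortProductOne (S : Multiset G) : Prop :=
  IsProductOne S ∧ 1 ≤ Multiset.card S ∧ Multiset.card S ≤ Monoid.exponent G

/-- `S` has a short product-one subsequence. -/
def HasShortProductOneSubseq (S : Multiset G) : Prop :=
  ∃ T : Multiset G, T ≤ S ∧ IsShortProductOne T

variable (G) in
/-- The constant `η(G)`: the smallest `ℓ > 0` such that every sequence over `G` of length at least
`ℓ` has a short product-one subsequence. (If there is no such `ℓ`, the value is `0`, so a positive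
value is always an attained minimum.) -/
noncomputable def eta : ℕ :=
  sInf {ℓ : ℕ | 0 < ℓ ∧ ∀ S : Multiset G, ℓ ≤ Multiset.card S → HasShortProductOneSubseq S}

end Sequences

section Group

/-- The relators of the presentation `⟨x, y ∣ x² = yⁿ = 1, y x = x yˢ⟩`, where `x` and `y` are the
free generators with index `0` and `1`. -/
def relators (n : ℕ) (s : ℤ) : Set (FreeGroup (Fin 2)) :=
  {FreeGroup.of 0 ^ 2,
   FreeGroup.of 1 ^ n,
   (FreeGroup.of 1 * FreeGroup.of 0) * (FreeGroup.of 0 * FreeGroup.of 1 ^ s)⁻¹}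

/-- The group `G_{n,s} = C_n ⋊_s C_2 = ⟨x, y ∣ x² = yⁿ = 1, y x = x yˢ⟩`. -/
abbrev Gns (n : ℕ) (s : ℤ) : Type :=
  PresentedGroup (relators n s)

/-- `G ≃ ⟨α, β ∣ α² = βⁿ = 1, β α = α βˢ⟩` for the elements `α`, `β` of `G`: the
presented group on the right is isomorphic to `G` by an isomorphism that sends its two generators
to `α` and `β`. -/
def IsPresentedBy {G : Type*} [Group G] (n : ℕ) (s : ℤ) (α β : G) : Prop :=
  ∃ e : PresentedGroup (relators n s) ≃* G,
    e (PresentedGroup.of 0) = α ∧ e (PresentedGroup.of 1) = β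

end Group

end ZeroSum

/-! For an abelian subgroup `A` of index two, a sequence `T` has excess `k` if at least
`|T| + 1 + k` elements of `A` are products of subsequences of `T`. By Scherk's theorem the excess is
superadditive along a decomposition of a product-one free sequence. A term in `A`, and a pair of
non-commuting terms outside `A`, have nonnegative excess. Commuting is an equivalence relation on
the complement of `A`; unless one of its classes dominates, the terms outside `A` can be grouped
with each other and with terms of `A` into pieces of nonnegative excess. A sequence of length
`|A|` cut up in this way cannot be product-one free, since only `|A|` elements are available.

Hence a product-one free `S` with `|S| = |A|` has at most one term outside `A`, or outside a
centralizer of index two when the centre has index four. The remaining `|A| - 1` terms lie in an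
abelian group of order `|A|`, where two distinct terms would have excess `1`; so they are all
equal to one element `β` of order `|A|`. In `G_{n,s}` every element `β` of order `n` satisfies
the defining relations together with `x`. -/

namespace ZeroSum

section Scherk

open scoped Pointwise

theorem exists_smul_not_subset {A : Type*} [CommGroup A] [DecidableEq A] {X Y : Finset A}
    (hX : 1 ∈ X) (hY : Y.Nontrivial) (hXY : ∀ x ∈ X, ∀ y ∈ Y, x * y = 1 → y = 1) :
    ∃ a ∈ X, ¬ a • Y ⊆ X := by
  by_contra! h
  obtain ⟨y, hy, hy1⟩ := hY.exists_ne 1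
  have hstab : y • X = X := Finset.eq_of_subset_of_card_le
    (fun z hz => by
      obtain ⟨x, hx, rfl⟩ := Finset.mem_smul_finset.1 hz
      rw [smul_eq_mul, mul_comm]
      exact h x hx (Finset.smul_mem_smul_finset hy))
    (Finset.card_smul_finset y X).ge
  obtain ⟨x, hx, hxy⟩ := Finset.mem_smul_finset.1 (hstab.symm ▸ hX)
  exact hy1 (hXY x hx y hy (by rwa [mul_comm]))

/-- The Kemperman–Scherk theorem for abelian groups. -/
theorem scherk {A : Type*} [CommGroup A] [DecidableEq A] (X Y : Finset A) (hX : 1 ∈ X)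
    (hY : 1 ∈ Y) (hXY : ∀ x ∈ X, ∀ y ∈ Y, x * y = 1 → y = 1) :
    X.card + Y.card ≤ (X * Y).card + 1 := by
  induction hm : Y.card using Nat.strong_induction_on generalizing X Y with | _ m ih
  by_cases hY1 : Y.Nontrivial
  · obtain ⟨a, ha, haY⟩ := exists_smul_not_subset hX hY1 hXY
    set Z := Finset.mulDysonETransform a (X, Y) with hZ
    have hcard : Z.1.card + Z.2.card = X.card + Y.card := Finset.mulDysonETransform.card a (X, Y)
    have hsub : Z.1 * Z.2 ⊆ X * Y := Finset.mulDysonETransform.subset a (X, Y)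
    have hXZ : X ⊂ Z.1 := Finset.ssubset_iff_subset_ne.2 ⟨Finset.subset_union_left, fun h =>
      haY (h ▸ Finset.subset_union_right)⟩
    have hlt := Finset.card_lt_card hXZ
    have hZ2 : ∀ y, y ∈ Z.2 ↔ y ∈ Y ∧ a * y ∈ X := fun y => by
      simp [hZ, Finset.mulDysonETransform, Finset.mem_inv_smul_finset_iff]
    have := ih Z.2.card (by omega) Z.1 Z.2 (hXZ.1 hX) ((hZ2 1).2 ⟨hY, by simpa⟩)
      (fun x hx y hy hxy => by
        rcases Finset.mem_union.1 hx with hx | hx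
        · exact hXY x hx y ((hZ2 y).1 hy).1 hxy
        · obtain ⟨b, hb, rfl⟩ := Finset.mem_smul_finset.1 hx
          have hb1 : b = 1 := hXY (a * y) ((hZ2 y).1 hy).2 b hb (by
            rw [← hxy, smul_eq_mul, mul_right_comm])
          subst hb1
          exact hXY a ha y ((hZ2 y).1 hy).1 (by simpa using hxy)) rfl
    have := Finset.card_le_card hsub
    omega
  · have hle : Y.card ≤ 1 := by
      rw [← Finset.one_lt_card_iff_nontrivial] at hY1
      omega
    have := Finset.card_le_card (Finset.subset_mul_left X hY)
    omega

end Scherk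

section Subproducts

variable {G : Type*} [Group G]

/-- A sequence none of whose nonempty subsequences is a product-one sequence. -/
def ProductOneFree (S : Multiset G) : Prop :=
  ∀ l : List G, l ≠ [] → (l : Multiset G) ≤ S → l.prod ≠ 1

theorem ProductOneFree.mono {S T : Multiset G} (hS : ProductOneFree S) (h : T ≤ S) :
    ProductOneFree T :=
  fun l h0 hl => hS l h0 (hl.trans h)

theorem ProductOneFree.ne_one {S : Multiset G} (hS : ProductOneFree S) {g : G} (hg : g ∈ S) :
    g ≠ 1 := by
  simpa using hS [g] (by simp) (by simpa using hg)

theorem ProductOneFree.mul_ne_one {S : Multiset G} (hS : ProductOneFree S) {g h : G}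
    (hgh : {g, h} ≤ S) : g * h ≠ 1 := by
  simpa using hS [g, h] (by simp) hgh

/-- The elements of the subgroup `A` that are products, in some order, of the terms of a possibly
empty subsequence of `T`. -/
def subproducts (A : Subgroup G) (T : Multiset G) : Set G :=
  {g | g ∈ A ∧ ∃ l : List G, (l : Multiset G) ≤ T ∧ l.prod = g}

variable {A : Subgroup G}

theorem subproducts_mono {T U : Multiset G} (h : T ≤ U) : subproducts A T ⊆ subproducts A U :=
  fun _ ⟨hg, l, hl, hlg⟩ => ⟨hg, l, hl.trans h, hlg⟩

theorem one_mem_subproducts (T : Multiset G) : 1 ∈ subproducts A T :=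
  ⟨A.one_mem, [], by simp, rfl⟩

theorem mul_mem_subproducts {T U : Multiset G} {g h : G} (hg : g ∈ subproducts A T)
    (hh : h ∈ subproducts A U) : g * h ∈ subproducts A (T + U) := by
  obtain ⟨hgA, l, hl, rfl⟩ := hg
  obtain ⟨hhA, m, hm, rfl⟩ := hh
  exact ⟨A.mul_mem hgA hhA, l ++ m, by simpa using add_le_add hl hm, by simp⟩

theorem ProductOneFree.eq_one_of_mul_eq_one {T U : Multiset G} (h : ProductOneFree (T + U))
    {g k : G} (hg : g ∈ subproducts A T) (hk : k ∈ subproducts A U) (hgk : g * k = 1) :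
    k = 1 := by
  obtain ⟨-, l, hl, rfl⟩ := hg
  obtain ⟨-, m, hm, rfl⟩ := hk
  have hlm : l ++ m = [] := by
    by_contra h0
    exact h (l ++ m) h0 (by simpa using add_le_add hl hm) (by simpa using hgk)
  rw [(List.append_eq_nil_iff.1 hlm).2, List.prod_nil]

/-- At least `|T| + 1 + k` elements of `A` are products of subsequences of `T`. Since this number
is superadditive along the parts of a product-one free sequence, so is the excess `k`. -/
def HasExcess (A : Subgroup G) (k : ℕ) (T : Multiset G) : Prop :=
  T.card + 1 + k ≤ (subproducts A T).ncard

theorem HasExcess.card_lt [Finite A] {k : ℕ} {T : Multiset G} (h : HasExcess A k T) :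
    T.card + k < Nat.card A := by
  have : (subproducts A T).ncard ≤ Nat.card A :=
    Set.ncard_le_ncard (fun _ hg => hg.1) (Set.toFinite (A : Set G))
  unfold HasExcess at h
  omega

theorem hasExcess_zero : HasExcess A 0 0 := by
  have : subproducts A 0 = {1} := by
    ext g
    simp +contextual [subproducts, eq_comm]
  simp [HasExcess, this]

theorem HasExcess.add_singleton [Finite A] {k : ℕ} {T : Multiset G} (h : HasExcess A (k + 1) T)
    (c : G) : HasExcess A k (T + {c}) := by
  have := Set.ncard_le_ncard (subproducts_mono (A := A) (Multiset.le_add_right T {c}))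
    ((Set.toFinite (A : Set G)).subset fun _ hg => hg.1)
  unfold HasExcess at h ⊢
  simp only [Multiset.card_add, Multiset.card_singleton]
  omega

theorem hasExcess_of_nodup [Finite A] {k : ℕ} {T : Multiset G} (L : List (List G))
    (hL : (L.map List.prod).Nodup) (hk : T.card + 1 + k ≤ L.length) (hA : ∀ l ∈ L, l.prod ∈ A)
    (hT : ∀ l ∈ L, (l : Multiset G) ≤ T) : HasExcess A k T := by
  classical
  have := Set.ncard_le_ncard (s := ((L.map List.prod).toFinset : Set G)) (t := subproducts A T)
    (fun g hg => by
      obtain ⟨l, hl, rfl⟩ := List.mem_map.1 (List.mem_toFinset.1 (Finset.mem_coe.1 hg))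
      exact ⟨hA l hl, l, hT l hl, rfl⟩)
    ((Set.toFinite (A : Set G)).subset fun _ hg => hg.1)
  rw [Set.ncard_coe_finset, List.toFinset_card_of_nodup hL, List.length_map] at this
  exact hk.trans this

open scoped IsMulCommutative Pointwise in
theorem HasExcess.add [Finite A] [IsMulCommutative A] {j k : ℕ} {T U : Multiset G}
    (hT : HasExcess A j T) (hU : HasExcess A k U) (h : ProductOneFree (T + U)) :
    HasExcess A (j + k) (T + U) := by
  classical
  have := Fintype.ofFinite A
  let P (V : Multiset G) : Finset A := {g | (g : G) ∈ subproducts A V}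
  have hP : ∀ V, (P V).card = (subproducts A V).ncard := fun V => by
    rw [← Set.ncard_coe_finset, ← Set.ncard_image_of_injective _ A.subtype_injective]
    congr
    ext g
    simpa [P] using fun hg : g ∈ subproducts A V => hg.1
  have hmul : P T * P U ⊆ P (T + U) := fun g hg => by
    obtain ⟨a, ha, b, hb, rfl⟩ := Finset.mem_mul.1 hg
    simp only [P, Finset.mem_filter_univ] at ha hb ⊢
    exact mul_mem_subproducts ha hb
  have := scherk (P T) (P U) (by simpa [P] using one_mem_subproducts T)
    (by simpa [P] using one_mem_subproducts U) fun a ha b hb hab => by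
      simp only [P, Finset.mem_filter_univ] at ha hb
      exact Subtype.ext (h.eq_one_of_mul_eq_one ha hb (by simpa using congrArg Subtype.val hab))
  have := Finset.card_le_card hmul
  simp only [HasExcess, ← hP, Multiset.card_add] at *
  omega

end Subproducts

section IndexTwo

variable {G : Type*} [Group G] {A : Subgroup G} [IsMulCommutative A]

theorem commute_of_mem {a b : G} (ha : a ∈ A) (hb : b ∈ A) : Commute a b :=
  congrArg Subtype.val (mul_comm' (⟨a, ha⟩ : A) ⟨b, hb⟩)

theorem mem_center_of_commute (hA : A.index = 2) {f h : G} (hf : f ∉ A) (hh : h ∈ A)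
    (hfh : Commute f h) : h ∈ Subgroup.center G := by
  refine Subgroup.mem_center_iff.2 fun g => ?_
  by_cases hg : g ∈ A
  · exact commute_of_mem hg hh
  · have hgf : g * f⁻¹ ∈ A := by simp [Subgroup.mul_mem_iff_of_index_two hA, hg, hf]
    have := (commute_of_mem hgf hh).mul_left hfh
    rwa [inv_mul_cancel_right] at this

theorem commute_trans_of_notMem (hA : A.index = 2) {f a b : G} (hf : f ∉ A) (ha : Commute f a)
    (hb : Commute f b) : Commute a b := by
  by_cases haA : a ∈ A
  · exact (Subgroup.mem_center_iff.1 (mem_center_of_commute hA hf haA ha) b).symm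
  · have haf : a * f⁻¹ ∈ A := by simp [Subgroup.mul_mem_iff_of_index_two hA, haA, hf]
    have hz := mem_center_of_commute hA hf haf (ha.mul_right (Commute.refl f).inv_right)
    have := Commute.mul_left (Subgroup.mem_center_iff.1 hz b).symm hb
    rwa [inv_mul_cancel_right] at this

end IndexTwo

section Pieces

variable {G : Type*} [Group G] {A : Subgroup G} [Finite A]

attribute [local grind =] Multiset.le_iff_count Multiset.coe_count Multiset.insert_eq_cons
  Multiset.count_cons Multiset.count_singleton

theorem hasExcess_singleton {h : G} (hh : h ∈ A) (hS : ProductOneFree {h}) : HasExcess A 0 {h} :=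
  hasExcess_of_nodup [[], [h]] (by simpa [eq_comm] using hS.ne_one (Multiset.mem_singleton_self h))
    (by simp) (by simpa using hh) (by simp)

theorem hasExcess_pair_of_ne {g h : G} (hg : g ∈ A) (hh : h ∈ A) (hne : g ≠ h)
    (hS : ProductOneFree {g, h}) : HasExcess A 1 {g, h} := by
  have hg1 : g ≠ 1 := hS.ne_one (by simp)
  have hh1 : h ≠ 1 := hS.ne_one (by simp)
  have hgh : g * h ≠ 1 := hS.mul_ne_one le_rfl
  refine hasExcess_of_nodup [[], [g], [h], [g, h]] ?_ (by simp) ?_ (by classical grind)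
  · simp [hg1, hg1.symm, hh1, hh1.symm, hgh.symm, hne]
  · simp [hg, hh, A.mul_mem]

theorem nodup_map_prod_of_not_commute {a b h : G} (hbh : ¬ Commute b h)
    (hS : ProductOneFree {a, b, h}) :
    ([[], [a, b], [a, b, h], [a, h, b]].map List.prod).Nodup := by
  have h1 : a * b ≠ 1 := hS.mul_ne_one (by classical grind)
  have h2 : a * (b * h) ≠ 1 := by simpa using hS [a, b, h] (by simp) le_rfl
  have h3 : a * (h * b) ≠ 1 := by simpa using hS [a, h, b] (by simp) (by classical grind)
  have h4 : h ≠ 1 := hS.ne_one (by simp)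
  rw [commute_iff_eq] at hbh
  simp [h1.symm, h2.symm, h3.symm, h4, hbh]

variable (hA : A.index = 2)
include hA

theorem hasExcess_pair {a b : G} (ha : a ∉ A) (hb : b ∉ A) (hab : ¬ Commute a b)
    (hS : ProductOneFree {a, b}) : HasExcess A 0 {a, b} := by
  have hab1 : a * b ≠ 1 := hS.mul_ne_one le_rfl
  have hba1 : b * a ≠ 1 := hS.mul_ne_one (by rw [Multiset.pair_comm])
  rw [commute_iff_eq] at hab
  refine hasExcess_of_nodup [[], [a, b], [b, a]] ?_ (by simp) ?_ (by classical grind)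
  · simp [hab1.symm, hba1.symm, hab]
  · simp [Subgroup.mul_mem_iff_of_index_two hA, ha, hb]

theorem hasExcess_pair_add_mem {a b h : G} (ha : a ∉ A) (hb : b ∉ A)
    (hh : h ∈ A) (hbh : ¬ Commute b h) (hS : ProductOneFree {a, b, h}) :
    HasExcess A 0 {a, b, h} :=
  hasExcess_of_nodup [[], [a, b], [a, b, h], [a, h, b]] (nodup_map_prod_of_not_commute hbh hS)
    (by simp) (by simp [Subgroup.mul_mem_iff_of_index_two hA, ha, hb, hh]) (by classical grind)

theorem hasExcess_triple_of_commute {a b c : G} (ha : a ∉ A) (hb : b ∉ A) (hc : c ∉ A)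
    (hab : ¬ Commute a b) (hbc : Commute b c) (hS : ProductOneFree {a, b, c}) :
    HasExcess A 0 {a, b, c} := by
  have hab1 : a * b ≠ 1 := hS.mul_ne_one (by classical grind)
  have hba1 : b * a ≠ 1 := hS.mul_ne_one (by classical grind)
  have hbc1 : b * c ≠ 1 := hS.mul_ne_one (by classical grind)
  have habc : a * b ≠ b * c := fun h => by
    rw [hbc.eq, mul_right_cancel_iff] at h
    exact hab (h ▸ hbc.symm)
  have hac : a ≠ c := fun h => hab (h ▸ hbc.symm)
  rw [commute_iff_eq] at hab
  refine hasExcess_of_nodup [[], [a, b], [b, a], [b, c]] ?_ (by simp) ?_ (by classical grind)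
  · simp [hab1.symm, hba1.symm, hbc1.symm, hab, habc, hac]
  · simp [Subgroup.mul_mem_iff_of_index_two hA, ha, hb, hc]

theorem hasExcess_triple_of_ne {a b c : G} (ha : a ∉ A) (hb : b ∉ A) (hc : c ∉ A)
    (hab : ¬ Commute a b) (hcb : c ≠ b) (hca : c * a ≠ a * b) (hS : ProductOneFree {a, b, c}) :
    HasExcess A 0 {a, b, c} := by
  have hab1 : a * b ≠ 1 := hS.mul_ne_one (by classical grind)
  have hba1 : b * a ≠ 1 := hS.mul_ne_one (by classical grind)
  have hca1 : c * a ≠ 1 := hS.mul_ne_one (by classical grind)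
  rw [commute_iff_eq] at hab
  refine hasExcess_of_nodup [[], [a, b], [b, a], [c, a]] ?_ (by simp) ?_ (by classical grind)
  · simp [hab1.symm, hba1.symm, hca1.symm, hab, hcb.symm, hca.symm]
  · simp [Subgroup.mul_mem_iff_of_index_two hA, ha, hb, hc]

end Pieces

section Products

theorem eq_of_mul_mem_of_commGroup {A : Type*} [CommGroup A] {v x y : A} (hx : x ≠ 1) (hy : y ≠ 1)
    (hxy : x ≠ y) (hvxy : v * x * y ∈ [v, v * x, v * y]) (hvxx : v * x * x ∈ [v, v * x, v * y]) :
    x * y = 1 ∧ x * x = y := by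
  have h1 : x * y = 1 := by
    simpa [mul_assoc, hx, hy] using hvxy
  have h2 : x * x = 1 ∨ x * x = y := by
    simpa [mul_assoc, hx] using hvxx
  exact ⟨h1, h2.resolve_left fun h => hxy (mul_left_cancel (h.trans h1.symm))⟩

theorem exists_notMem_of_commGroup {A : Type*} [CommGroup A] {v w h k : A} (hh : h ≠ 1)
    (hk : k ≠ 1) (hhk : h ≠ k) (hvw : v ≠ w) (hv : v ≠ 1) (hvh : v * h ≠ 1) (hvk : v * k ≠ 1)
    (hw : w ≠ 1) (hwh : w * h ≠ 1) (hwk : w * k ≠ 1) :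
    ∃ x ∈ [w, w * h, w * k, h], x ∉ [1, v, v * h, v * k] := by
  by_contra! hcon
  have hh' : h = v ∨ h = v * k := by simpa [hh, hv] using hcon h (by simp)
  have hwh' : w * h ∈ [v, v * h, v * k] := by simpa [hwh] using hcon (w * h) (by simp)
  have hwk' : w * k ∈ [v, v * h, v * k] := by simpa [hwk] using hcon (w * k) (by simp)
  have hw' : w = v * h ∨ w = v * k := by simpa [hw, hvw.symm] using hcon w (by simp)
  rcases hw' with rfl | rfl
  · obtain ⟨h1, h2⟩ := eq_of_mul_mem_of_commGroup hh hk hhk hwk' hwh'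
    rcases hh' with rfl | hvk'
    · exact hvk h1
    · rw [← h2, ← mul_assoc] at hvk'
      exact hvh (by simpa using hvk'.symm)
  · obtain ⟨h1, h2⟩ := eq_of_mul_mem_of_commGroup hk hh hhk.symm
      (by simpa [or_comm, or_left_comm] using hwh') (by simpa [or_comm, or_left_comm] using hwk')
    rcases hh' with rfl | hvk'
    · exact hvk (by rw [mul_comm, h1])
    · rw [← h2, mul_left_inj] at hvk'
      exact hvh (hvk' ▸ h1)

theorem nodup_of_central_involution {G : Type*} [Group G] {v h g : G} (hv : ∀ x, Commute v x)
    (hvv : v * v = 1) (hv1 : v ≠ 1) (hh1 : h ≠ 1) (hg1 : g ≠ 1) (hhv : h ≠ v) (hgv : g ≠ v)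
    (hvh : v * h ≠ 1) (hhg : h * g ≠ 1) (hvg : v * g ≠ 1) (hvhg : v * h * g ≠ 1) :
    [1, v, h, v * h, h * g, v * h * g].Nodup := by
  have h1 : h ≠ v * h * g := fun h' => hvg (by
    rw [(hv h).eq, mul_assoc] at h'
    simpa using h')
  have h2 : v ≠ h * g := fun h' => hvhg (by rw [mul_assoc, ← h', hvv])
  have h3 : v * h ≠ h * g := fun h' => hgv (by
    rw [(hv h).eq] at h'
    exact (mul_left_cancel h').symm)
  have h4 : v ≠ v * h * g := fun h' => hhg (by simpa [mul_assoc] using h')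
  have h5 : h * g ≠ v * h * g := by simpa [mul_assoc] using hv1
  simp [hv1, hv1.symm, hh1, hh1.symm, hg1, hhv.symm, hvh.symm, hhg.symm, hvhg.symm, h1, h2, h3, h4,
    h5]

end Products

section LargePieces

variable {G : Type*} [Group G] {A : Subgroup G} [Finite A] (hA : A.index = 2)
include hA

theorem hasExcess_triple_or {a b c : G} (ha : a ∉ A) (hb : b ∉ A) (hc : c ∉ A)
    (hab : ¬ Commute a b) (hS : ProductOneFree {a, b, c}) :
    HasExcess A 0 {a, b, c} ∨ ¬ Commute a c ∧ ¬ Commute b c ∧ c * a = a * b := by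
  by_cases hbc : Commute b c
  · exact .inl (hasExcess_triple_of_commute hA ha hb hc hab hbc hS)
  by_cases hac : Commute a c
  · have hswap : ({a, b, c} : Multiset G) = {b, a, c} := Multiset.cons_swap a b {c}
    rw [hswap] at hS ⊢
    exact .inl (hasExcess_triple_of_commute hA hb ha hc (fun h => hab h.symm) hac hS)
  by_cases hca : c * a = a * b
  · exact .inr ⟨hac, hbc, hca⟩
  · exact .inl (hasExcess_triple_of_ne hA ha hb hc hab (fun h => hbc (h ▸ Commute.refl b)) hca hS)

theorem hasExcess_quintuple [IsMulCommutative A] {a b c d e : G} (ha : a ∉ A) (hb : b ∉ A)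
    (hc : c ∉ A) (hd : d ∉ A) (he : e ∉ A) (hab : ¬ Commute a b) (hde : ¬ Commute d e)
    (hS : ProductOneFree ({a, b, c} + {d, e})) : HasExcess A 0 ({a, b, c} + {d, e}) := by
  have hdec : ({a, b, c} + {d, e} : Multiset G) = {d, e, c} + {a, b} := by
    simp only [Multiset.insert_eq_cons, ← Multiset.singleton_add]
    abel
  have habd : ({a, b, c} + {d, e} : Multiset G) = {a, b, d} + {c, e} := by
    simp only [Multiset.insert_eq_cons, ← Multiset.singleton_add]
    abel
  rcases hasExcess_triple_or hA ha hb hc hab (hS.mono (Multiset.le_add_right _ _)) with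
    h | ⟨-, -, hca⟩
  · exact h.add (hasExcess_pair hA hd he hde (hS.mono (Multiset.le_add_left _ _))) hS
  rcases hasExcess_triple_or hA hd he hc hde (hS.mono (hdec ▸ Multiset.le_add_right _ _)) with
    h | ⟨hdc, hec, -⟩
  · rw [hdec] at hS ⊢
    exact h.add (hasExcess_pair hA ha hb hab (hS.mono (Multiset.le_add_left _ _))) hS
  rw [habd] at hS ⊢
  rcases hasExcess_triple_or hA ha hb hd hab (hS.mono (Multiset.le_add_right _ _)) with
    h | ⟨-, -, hda⟩
  · exact h.add (hasExcess_pair hA hc he (fun h => hec h.symm)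
      (hS.mono (Multiset.le_add_left _ _))) hS
  · have hdc' : d = c := mul_right_cancel (hda.trans hca.symm)
    exact absurd (hdc' ▸ Commute.refl d) hdc

attribute [local grind =] Multiset.le_iff_count Multiset.coe_count Multiset.insert_eq_cons
  Multiset.count_cons Multiset.count_singleton

omit [Finite A] in
theorem exists_mem_mul_mul_eq [IsMulCommutative A] {a b h : G} (ha : a ∉ A) (hb : b ∉ A)
    (hh : h ∈ A) : ∃ k ∈ A, a * b * k = a * h * b ∧ b * a * k = b * h * a := by
  have hab : a * b⁻¹ ∈ A := by simp [Subgroup.mul_mem_iff_of_index_two hA, ha, hb]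
  refine ⟨b⁻¹ * h * b, by simp [Subgroup.mul_mem_iff_of_index_two hA, hb, hh], by group, ?_⟩
  calc b * a * (b⁻¹ * h * b) = b * (a * b⁻¹ * h) * b := by group
    _ = b * (h * (a * b⁻¹)) * b := by rw [(commute_of_mem hab hh).eq]
    _ = b * h * a := by group

omit [Finite A] hA in
theorem exists_coe_le_prod_eq {a b h k x : G} (hk : b * a * k = b * h * a)
    (hx : x ∈ [b * a, b * a * h, b * a * k, h]) :
    ∃ l : List G, (l : Multiset G) ≤ {a, b, h} ∧ l.prod = x := by
  simp only [List.mem_cons, List.not_mem_nil, or_false] at hx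
  rcases hx with rfl | rfl | rfl | hxh
  · exact ⟨[b, a], by classical grind, by simp⟩
  · exact ⟨[b, a, h], by classical grind, by simp [mul_assoc]⟩
  · exact ⟨[b, h, a], by classical grind, by simp [mul_assoc, hk]⟩
  · exact ⟨[h], by classical grind, by simp [hxh]⟩

open scoped IsMulCommutative in
omit [Finite A] in
theorem exists_prod_notMem [IsMulCommutative A] {a b h : G} (ha : a ∉ A) (hb : b ∉ A) (hh : h ∈ A)
    (hab : ¬ Commute a b) (hbh : ¬ Commute b h) (hS : ProductOneFree {a, b, h}) :
    ∃ l : List G, (l : Multiset G) ≤ {a, b, h} ∧ l.prod ∈ A ∧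
      l.prod ∉ [1, a * b, a * b * h, a * h * b] := by
  obtain ⟨k, hk, hkab, hkba⟩ := exists_mem_mul_mul_eq hA ha hb hh
  have hvA : a * b ∈ A := by simp [Subgroup.mul_mem_iff_of_index_two hA, ha, hb]
  have hwA : b * a ∈ A := by simp [Subgroup.mul_mem_iff_of_index_two hA, ha, hb]
  have hfree : ∀ l ∈ [[h], [a, b], [a, b, h], [a, h, b], [b, a], [b, a, h], [b, h, a]],
      l.prod ≠ 1 := by
    simp only [List.forall_mem_cons]
    refine ⟨hS _ ?_ ?_, hS _ ?_ ?_, hS _ ?_ ?_, hS _ ?_ ?_, hS _ ?_ ?_, hS _ ?_ ?_, hS _ ?_ ?_,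
      by simp⟩ <;> classical grind
  simp only [List.forall_mem_cons, List.prod_cons, List.prod_nil, mul_one, ← mul_assoc, ← hkab,
    ← hkba] at hfree
  obtain ⟨hh1, hv, hvh, hvk, hw, hwh, hwk, -⟩ := hfree
  have hkh : h ≠ k := by
    rintro rfl
    rw [mul_assoc, mul_assoc, mul_right_inj] at hkab
    exact hbh hkab
  have hk1 : k ≠ 1 := by
    rintro rfl
    exact hh1 (by simpa [mul_assoc] using hkab)
  obtain ⟨x, hx, hx'⟩ := exists_notMem_of_commGroup (v := (⟨a * b, hvA⟩ : A)) (w := ⟨b * a, hwA⟩)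
    (h := ⟨h, hh⟩) (k := ⟨k, hk⟩) (by simpa) (by simpa) (by simpa) (by simpa) (by simpa)
    (by simpa) (by simpa) (by simpa) (by simpa) (by simpa)
  obtain ⟨l, hl, hlx⟩ := exists_coe_le_prod_eq hkba (List.mem_map_of_mem (f := A.subtype) hx)
  refine ⟨l, hl, hlx ▸ x.2, fun hl' => hx' ?_⟩
  simpa only [hlx, Subgroup.subtype_apply, List.mem_cons, List.not_mem_nil, or_false,
    Subtype.ext_iff, Subgroup.coe_mul, Subgroup.coe_one, hkab] using hl'

theorem hasExcess_pair_add_mem_one [IsMulCommutative A] {a b h : G} (ha : a ∉ A) (hb : b ∉ A)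
    (hh : h ∈ A) (hab : ¬ Commute a b) (hbh : ¬ Commute b h) (hS : ProductOneFree {a, b, h}) :
    HasExcess A 1 {a, b, h} := by
  obtain ⟨l, hl, hlA, hlP⟩ := exists_prod_notMem hA ha hb hh hab hbh hS
  refine hasExcess_of_nodup [l, [], [a, b], [a, b, h], [a, h, b]] ?_ (by simp) ?_ ?_
  · rw [List.map_cons, List.nodup_cons]
    exact ⟨by simpa [mul_assoc] using hlP, nodup_map_prod_of_not_commute hbh hS⟩
  · simp [hlA, Subgroup.mul_mem_iff_of_index_two hA, ha, hb, hh]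
  · rw [List.forall_mem_cons]
    exact ⟨hl, by classical grind⟩

omit [Finite A] in
theorem mul_self_eq_one_of_eq_mul_mul [IsMulCommutative A] {a b h : G} (ha : a ∉ A) (hb : b ∉ A)
    (hh : h ∈ A) (hab : Commute a b) (hv : Commute (a * b) h) (hahb : h = a * h * b) :
    a * b * (a * b) = 1 := by
  obtain ⟨k, -, hk, hk'⟩ := exists_mem_mul_mul_eq hA ha hb hh
  rw [hab.eq, hk'] at hk
  refine mul_right_cancel (b := h) ?_
  calc a * b * (a * b) * h = a * (b * h * a) * b := by
        rw [mul_assoc (a * b), hv.eq]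
        group
    _ = 1 * h := by rw [hk, ← hahb, ← hahb, one_mul]

omit [Finite A] hA in
theorem nodup_map_prod_of_involution {a b h g : G} (hv : ∀ x, Commute (a * b) x)
    (hvv : a * b * (a * b) = 1) (hah : ¬ Commute a h) (hag : ¬ Commute a g)
    (hS : ProductOneFree {a, b, h, g}) :
    ([[], [a, b], [h], [a, b, h], [h, g], [a, b, h, g]].map List.prod).Nodup := by
  have hfree : ∀ l ∈ [[a, b], [h], [g], [h, g], [a, b, h], [a, b, g], [a, b, h, g]],
      l.prod ≠ 1 := by
    simp only [List.forall_mem_cons]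
    refine ⟨hS _ ?_ ?_, hS _ ?_ ?_, hS _ ?_ ?_, hS _ ?_ ?_, hS _ ?_ ?_, hS _ ?_ ?_, hS _ ?_ ?_,
      by simp⟩ <;> classical grind
  simp only [List.forall_mem_cons, List.prod_cons, List.prod_nil, mul_one, ← mul_assoc] at hfree
  obtain ⟨hv1, hh1, hg1, hhg1, hvh1, hvg1, hvhg1, -⟩ := hfree
  simpa [mul_assoc] using nodup_of_central_involution hv hvv hv1 hh1 hg1
    (fun h' => hah (h' ▸ (hv a).symm)) (fun h' => hag (h' ▸ (hv a).symm)) hvh1 hhg1 hvg1 hvhg1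

theorem hasExcess_commute_pair_add_pair [IsMulCommutative A] {a b h g : G} (ha : a ∉ A)
    (hb : b ∉ A) (hh : h ∈ A) (hg : g ∈ A) (hab : Commute a b) (hah : ¬ Commute a h)
    (hag : ¬ Commute a g) (hS : ProductOneFree ({a, b, h} + {g})) :
    HasExcess A 1 ({a, b, h} + {g}) := by
  have hvA : a * b ∈ A := by simp [Subgroup.mul_mem_iff_of_index_two hA, ha, hb]
  have hv : ∀ x, Commute (a * b) x := fun x => (Subgroup.mem_center_iff.1
    (mem_center_of_commute hA ha hvA ((Commute.refl a).mul_right hab)) x).symm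
  have hbh : ¬ Commute b h := fun h' => hah (commute_trans_of_notMem hA hb hab.symm h')
  have hh1 : h ≠ 1 := hS.ne_one (by simp)
  have hvh : h ≠ a * b := fun h' => hah (h' ▸ (hv a).symm)
  have hv1 : a * b ≠ 1 := hS.mul_ne_one (by classical grind [Multiset.count_add])
  by_cases hahb : h = a * h * b
  · have hvv := mul_self_eq_one_of_eq_mul_mul hA ha hb hh hab (hv h) hahb
    have hquad : ({a, b, h} + {g} : Multiset G) = {a, b, h, g} := rfl
    rw [hquad] at hS ⊢
    exact hasExcess_of_nodup [[], [a, b], [h], [a, b, h], [h, g], [a, b, h, g]]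
      (nodup_map_prod_of_involution hv hvv hah hag hS) (by simp)
      (by simp [Subgroup.mul_mem_iff_of_index_two hA, ha, hb, hh, hg]) (by classical grind)
  · have h1 : HasExcess A 1 {a, b, h} := by
      refine hasExcess_of_nodup [[h], [], [a, b], [a, b, h], [a, h, b]] ?_ (by simp) ?_
        (by classical grind)
      · rw [List.map_cons, List.nodup_cons]
        refine ⟨?_, nodup_map_prod_of_not_commute hbh (hS.mono (Multiset.le_add_right _ _))⟩
        simp [hh1, hvh, ← mul_assoc, hv1, hahb]
      · simp [Subgroup.mul_mem_iff_of_index_two hA, ha, hb, hh]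
    exact h1.add (hasExcess_singleton hg (hS.mono (Multiset.le_add_left _ _))) hS

end LargePieces

section Splitting

variable {α : Type*}

theorem exists_eq_add_of_le_card {S : Multiset α} {k : ℕ} (h : k ≤ S.card) :
    ∃ T U, S = T + U ∧ T.card = k := by
  refine ⟨(S.toList.take k : List α), (S.toList.drop k : List α), ?_, by simpa using h⟩
  rw [Multiset.coe_add, List.take_append_drop, Multiset.coe_toList]

theorem exists_eq_singleton_add {S : Multiset α} (h : 1 ≤ S.card) : ∃ a T, S = {a} + T := by
  obtain ⟨T, U, rfl, hT⟩ := exists_eq_add_of_le_card h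
  obtain ⟨a, rfl⟩ := Multiset.card_eq_one.1 hT
  exact ⟨a, U, rfl⟩

theorem exists_eq_pair_add {S : Multiset α} (h : 2 ≤ S.card) : ∃ a b T, S = {a, b} + T := by
  obtain ⟨T, U, rfl, hT⟩ := exists_eq_add_of_le_card h
  obtain ⟨a, b, rfl⟩ := Multiset.card_eq_two.1 hT
  exact ⟨a, b, U, rfl⟩

end Splitting

section Excess

variable {G : Type*} [Group G] {A : Subgroup G} [Finite A] [IsMulCommutative A]

theorem hasExcess_of_forall_mem {T : Multiset G} (hT : ∀ g ∈ T, g ∈ A) (hS : ProductOneFree T) :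
    HasExcess A 0 T := by
  induction T using Multiset.induction with
  | empty => exact hasExcess_zero
  | cons g T ih =>
    rw [← Multiset.singleton_add] at hS ⊢
    simp only [Multiset.forall_mem_cons] at hT
    exact (hasExcess_singleton hT.1 (hS.mono (Multiset.le_add_right _ _))).add
      (ih hT.2 (hS.mono (Multiset.le_add_left _ _))) hS

theorem ProductOneFree.card_lt_of_forall_mem {T : Multiset G} (hS : ProductOneFree T)
    (hT : ∀ g ∈ T, g ∈ A) : T.card < Nat.card A :=
  (hasExcess_of_forall_mem hT hS).card_lt

variable (hA : A.index = 2)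
include hA

theorem hasExcess_of_card_le_two_mul {K R : Multiset G} (hK : ∀ l ∈ K, l ∉ A)
    (hR : ∀ h ∈ R, h ∈ A) (hKK : ∀ l ∈ K, ∀ l' ∈ K, Commute l l')
    (hKR : ∀ l ∈ K, ∀ h ∈ R, ¬ Commute l h) (hcard : K.card ≤ 2 * R.card) (h1 : K.card ≠ 1)
    (hS : ProductOneFree (K + R)) : HasExcess A 0 (K + R) := by
  induction hm : K.card using Nat.strong_induction_on generalizing K R with | _ m ih
  by_cases h0 : K.card = 0
  · rw [Multiset.card_eq_zero.1 h0, zero_add] at hS ⊢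
    exact hasExcess_of_forall_mem hR hS
  obtain ⟨l, l', K, rfl⟩ := exists_eq_pair_add (S := K) (by omega)
  obtain ⟨h, R, rfl⟩ := exists_eq_singleton_add (S := R) (by omega)
  simp only [Multiset.insert_eq_cons, Multiset.cons_add, Multiset.singleton_add,
    Multiset.forall_mem_cons, Multiset.card_cons] at hK hR hKK hKR hcard hm h1
  have hsplit : {l, l'} + K + ({h} + R) = {l, l', h} + (K + R) := by
    simp only [Multiset.insert_eq_cons, ← Multiset.singleton_add]
    abel
  by_cases hK1 : K.card = 1
  · obtain ⟨c, rfl⟩ := Multiset.card_eq_one.1 hK1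
    obtain ⟨g, R, rfl⟩ := exists_eq_singleton_add (S := R) (by omega)
    simp only [Multiset.singleton_add, Multiset.forall_mem_cons] at hR hKR
    have hsplit' : {l, l'} + {c} + ({h} + ({g} + R)) = {l, l', h} + {g} + {c} + R := by
      simp only [Multiset.insert_eq_cons, ← Multiset.singleton_add]
      abel
    rw [hsplit'] at hS ⊢
    have hstrict := hasExcess_commute_pair_add_pair hA hK.1 hK.2.1 hR.1 hR.2.1 hKK.1.2.1
      hKR.1.1 hKR.1.2.1 (hS.mono ((Multiset.le_add_right _ {c}).trans (Multiset.le_add_right _ R)))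
    exact (hstrict.add_singleton c).add
      (hasExcess_of_forall_mem hR.2.2 (hS.mono (Multiset.le_add_left _ _))) hS
  · rw [hsplit] at hS ⊢
    exact (hasExcess_pair_add_mem hA hK.1 hK.2.1 hR.1 hKR.2.1.1
      (hS.mono (Multiset.le_add_right _ _))).add
      (ih K.card (by omega) hK.2.2 hR.2 (fun a ha => (hKK.2.2 a ha).2.2)
        (fun a ha => (hKR.2.2 a ha).2) (by omega) hK1 (hS.mono (Multiset.le_add_left _ _)) rfl) hS

theorem hasExcess_of_card_le_card {K Q : Multiset G} (hK : ∀ l ∈ K, l ∉ A) (hQ : ∀ q ∈ Q, q ∉ A)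
    (hKK : ∀ l ∈ K, ∀ l' ∈ K, Commute l l') (hQK : ∀ q ∈ Q, ∀ l ∈ K, ¬ Commute q l)
    (hle : Q.card ≤ K.card) (hcard : K.card ≤ 2 * Q.card) (hS : ProductOneFree (K + Q)) :
    HasExcess A 0 (K + Q) := by
  induction Q using Multiset.induction generalizing K with
  | empty =>
    obtain rfl : K = 0 := by simpa using hcard
    exact hasExcess_zero
  | cons q Q ih =>
    simp only [Multiset.forall_mem_cons, Multiset.card_cons] at hQ hQK hle hcard
    by_cases hlt : Q.card + 1 < K.card
    · obtain ⟨l, l', K, rfl⟩ := exists_eq_pair_add (S := K) (by omega)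
      simp only [Multiset.insert_eq_cons, Multiset.cons_add, Multiset.singleton_add,
        Multiset.forall_mem_cons, Multiset.card_cons] at hK hKK hQK hle hcard hlt
      have hsplit : {l, l'} + K + q ::ₘ Q = {q, l, l'} + (K + Q) := by
        simp only [Multiset.insert_eq_cons, ← Multiset.singleton_add]
        abel
      rw [hsplit] at hS ⊢
      exact (hasExcess_triple_of_commute hA hQ.1 hK.1 hK.2.1 hQK.1.1 hKK.1.2.1
        (hS.mono (Multiset.le_add_right _ _))).add
        (ih hK.2.2 hQ.2 (fun a ha => (hKK.2.2 a ha).2.2) (fun a ha => (hQK.2 a ha).2.2)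
          (by omega) (by omega) (hS.mono (Multiset.le_add_left _ _))) hS
    · obtain ⟨l, K, rfl⟩ := exists_eq_singleton_add (S := K) (by omega)
      simp only [Multiset.singleton_add, Multiset.forall_mem_cons, Multiset.card_cons]
        at hK hKK hQK hle hcard hlt
      have hsplit : {l} + K + q ::ₘ Q = {q, l} + (K + Q) := by
        simp only [Multiset.insert_eq_cons, ← Multiset.singleton_add]
        abel
      rw [hsplit] at hS ⊢
      exact (hasExcess_pair hA hQ.1 hK.1 hQK.1.1 (hS.mono (Multiset.le_add_right _ _))).add
        (ih hK.2 hQ.2 (fun a ha => (hKK.2 a ha).2) (fun a ha => (hQK.2 a ha).2)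
          (by omega) (by omega) (hS.mono (Multiset.le_add_left _ _))) hS

theorem hasExcess_of_majority {K Q R : Multiset G} (hK : ∀ l ∈ K, l ∉ A) (hQ : ∀ q ∈ Q, q ∉ A)
    (hR : ∀ h ∈ R, h ∈ A) (hKK : ∀ l ∈ K, ∀ l' ∈ K, Commute l l')
    (hQK : ∀ q ∈ Q, ∀ l ∈ K, ¬ Commute q l) (hKR : ∀ l ∈ K, ∀ h ∈ R, ¬ Commute l h)
    (hle : Q.card ≤ K.card) (hcard : K.card ≤ 2 * (Q.card + R.card)) (h1 : K.card + Q.card ≠ 1)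
    (hS : ProductOneFree (K + Q + R)) : HasExcess A 0 (K + Q + R) := by
  obtain ⟨m, hmK, hmR, hm1, hQm, hmQ⟩ : ∃ m ≤ K.card, m ≤ 2 * R.card ∧ m ≠ 1 ∧
      Q.card ≤ K.card - m ∧ K.card - m ≤ 2 * Q.card := by
    by_cases h : K.card = 2 * Q.card + 1
    · exact ⟨2, by omega⟩
    · exact ⟨K.card - 2 * Q.card, by omega⟩
  obtain ⟨L, K, rfl, rfl⟩ := exists_eq_add_of_le_card hmK
  simp only [Multiset.mem_add, or_imp, forall_and, Multiset.card_add, add_tsub_cancel_left] at *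
  rw [show L + K + Q + R = L + R + (K + Q) by abel] at hS ⊢
  exact (hasExcess_of_card_le_two_mul hA hK.1 hR hKK.1.1 hKR.1 hmR hm1
    (hS.mono (Multiset.le_add_right _ _))).add
    (hasExcess_of_card_le_card hA hK.2 hQ hKK.2.2 hQK.2 hQm hmQ
      (hS.mono (Multiset.le_add_left _ _))) hS

end Excess

section Classes

theorem countP_add_countP_le_card {α : Type*} {p q : α → Prop} [DecidablePred p]
    [DecidablePred q] {S : Multiset α}
    (h : ∀ a ∈ S, p a → ¬ q a) : S.countP p + S.countP q ≤ S.card := by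
  induction S using Multiset.induction with
  | empty => simp
  | cons a S ih =>
    simp only [Multiset.forall_mem_cons] at h
    have := ih h.2
    have := h.1
    simp only [Multiset.countP_cons, Multiset.card_cons]
    split_ifs <;> first | omega | simp_all

variable {G : Type*} [Group G] {A : Subgroup G} [Finite A] [IsMulCommutative A]
  (hA : A.index = 2)
include hA

open scoped Classical in
omit [Finite A] in
theorem two_mul_countP_le_of_cons_cons {l a : G} {F : Multiset G} (hF : ∀ x ∈ F, x ∉ A)
    (hla : ¬ Commute l a)
    (hmin : ∀ x ∈ F, 2 * (l ::ₘ a ::ₘ F).countP (Commute x) ≤ F.card + 3)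
    (hmax : ∀ x ∈ F,
      (l ::ₘ a ::ₘ F).countP (Commute x) ≤ (l ::ₘ a ::ₘ F).countP (Commute l)) :
    ∀ x ∈ F, 2 * F.countP (Commute x) ≤ F.card + 1 := fun x hx => by
  have h1 := hmin x hx
  have h2 := hmax x hx
  simp only [Multiset.countP_cons, Commute.refl, hla, if_true, if_false, add_zero] at h1 h2
  by_cases hxl : Commute x l
  · simp only [hxl, if_true] at h1
    omega
  by_cases hxa : Commute x a
  · simp only [hxa, if_true] at h1
    omega
  have := countP_add_countP_le_card fun y (hy : y ∈ F) (hxy : Commute x y) (hly : Commute l y) =>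
    hxl (commute_trans_of_notMem hA (hF y hy) hxy.symm hly.symm)
  simp only [hxl, hxa, if_false] at h2
  omega

open scoped Classical in
theorem hasExcess_or_of_two_mul_countP_le {F : Multiset G} (hF : ∀ l ∈ F, l ∉ A)
    (hmin : ∀ l ∈ F, 2 * F.countP (Commute l) ≤ F.card + 1) (hS : ProductOneFree F) :
    HasExcess A 0 F ∨ F.card = 1 ∨ ∃ a b c, F = {a, b, c} ∧ ¬ Commute a b := by
  induction hm : F.card using Nat.strong_induction_on generalizing F with | _ m ih
  rcases eq_or_ne F 0 with rfl | h0
  · exact .inl hasExcess_zero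
  obtain ⟨l, hl, hmax⟩ := Multiset.exists_max_image (fun l => F.countP (Commute l)) h0
  by_cases hall : ∀ a ∈ F, Commute l a
  · have := hmin l hl
    rw [Multiset.countP_eq_card.2 hall] at this
    have := Multiset.card_pos.2 h0
    exact .inr (.inl (by omega))
  push Not at hall
  obtain ⟨a, haF, hla⟩ := hall
  obtain ⟨F, rfl⟩ := Multiset.exists_cons_of_mem hl
  have haF' : a ∈ F := (Multiset.mem_cons.1 haF).resolve_left fun h => hla (h ▸ Commute.refl l)
  obtain ⟨F, rfl⟩ := Multiset.exists_cons_of_mem haF'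
  simp only [Multiset.forall_mem_cons, Multiset.card_cons] at hF hmin hm hmax
  have hmin' := two_mul_countP_le_of_cons_cons hA hF.2.2 hla hmin.2.2 hmax.2.2
  have hsplit : l ::ₘ a ::ₘ F = {l, a} + F := by simp
  rw [hsplit] at hS ⊢
  have hpair := hasExcess_pair hA hF.1 hF.2.1 hla (hS.mono (Multiset.le_add_right _ _))
  rcases ih F.card (by omega) hF.2.2 hmin' (hS.mono (Multiset.le_add_left _ _)) rfl with
    h | h | ⟨b, b', c, rfl, hbb'⟩
  · exact .inl (hpair.add h hS)
  · obtain ⟨c, rfl⟩ := Multiset.card_eq_one.1 h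
    exact .inr (.inr ⟨l, a, c, by simp, hla⟩)
  · rw [add_comm] at hS ⊢
    simp only [Multiset.forall_mem_cons, Multiset.insert_eq_cons, Multiset.mem_singleton,
      forall_eq] at hF
    exact .inl (hasExcess_quintuple hA hF.2.2.1 hF.2.2.2.1 hF.2.2.2.2 hF.1 hF.2.1 hbb' hla hS)

theorem hasExcess_triple_add {a b c : G} {E : Multiset G} (ha : a ∉ A) (hb : b ∉ A)
    (hab : ¬ Commute a b) (hE : ∀ h ∈ E, h ∈ A) (hcentral : ∃ h ∈ E, h ∉ Subgroup.center G)
    (hS : ProductOneFree ({a, b, c} + E)) : HasExcess A 0 ({a, b, c} + E) := by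
  obtain ⟨h, hhE, hh⟩ := hcentral
  obtain ⟨E, rfl⟩ := Multiset.exists_cons_of_mem hhE
  rw [Multiset.forall_mem_cons] at hE
  have hsplit : {a, b, c} + h ::ₘ E = {a, b, h} + {c} + E := by
    simp only [Multiset.insert_eq_cons, ← Multiset.singleton_add]
    abel
  rw [hsplit] at hS ⊢
  have hstrict := hasExcess_pair_add_mem_one hA ha hb hE.1 hab
    (fun hbh => hh (mem_center_of_commute hA hb hE.1 hbh))
    (hS.mono ((Multiset.le_add_right _ _).trans (Multiset.le_add_right _ _)))
  exact (hstrict.add_singleton c).add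
    (hasExcess_of_forall_mem hE.2 (hS.mono (Multiset.le_add_left _ _))) hS

open scoped Classical in
theorem hasExcess_of_lt_two_mul_countP {F E : Multiset G} (hF : ∀ l ∈ F, l ∉ A)
    (hE : ∀ h ∈ E, h ∈ A) {l : G} (hl : l ∈ F)
    (hclass : F.countP (Commute l) ≤ 2 * ((F + E).countP fun g => ¬ Commute l g))
    (hmaj : F.card + 1 < 2 * F.countP (Commute l)) (hS : ProductOneFree (F + E)) :
    HasExcess A 0 (F + E) := by
  have hFl := F.filter_add_not (Commute l)
  have hEl := E.filter_add_not (Commute l)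
  have hcard := congrArg Multiset.card hFl
  rw [Multiset.countP_eq_card_filter] at hmaj hclass
  rw [Multiset.countP_eq_card_filter, Multiset.filter_add, Multiset.card_add] at hclass
  set K := F.filter (Commute l)
  set Q := F.filter fun g => ¬ Commute l g
  set R := E.filter fun g => ¬ Commute l g
  rw [Multiset.card_add] at hcard
  have hsplit : F + E = K + Q + R + E.filter (Commute l) := by
    rw [hFl, add_assoc, add_comm R, hEl]
  rw [hsplit] at hS ⊢
  have hK : ∀ k ∈ K, k ∈ F ∧ Commute l k := fun k => Multiset.mem_filter.1
  have hQ : ∀ q ∈ Q, q ∈ F ∧ ¬ Commute l q := fun q => Multiset.mem_filter.1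
  have hR : ∀ h ∈ R, h ∈ E ∧ ¬ Commute l h := fun h => Multiset.mem_filter.1
  have htrans : ∀ k ∈ K, ∀ g, Commute k g → Commute l g := fun k hk g hkg =>
    commute_trans_of_notMem hA (hF k (hK k hk).1) (hK k hk).2.symm hkg
  have hmajority : HasExcess A 0 (K + Q + R) :=
    hasExcess_of_majority hA (fun k hk => hF k (hK k hk).1) (fun q hq => hF q (hQ q hq).1)
      (fun h hh => hE h (hR h hh).1)
      (fun k hk k' hk' => commute_trans_of_notMem hA (hF l hl) (hK k hk).2 (hK k' hk').2)
      (fun q hq k hk hqk => (hQ q hq).2 (htrans k hk q hqk.symm))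
      (fun k hk h hh hkh => (hR h hh).2 (htrans k hk h hkh)) (by omega) hclass
      (by omega) (hS.mono (Multiset.le_add_right _ _))
  exact hmajority.add (hasExcess_of_forall_mem (fun h hh => hE h (Multiset.mem_of_mem_filter hh))
    (hS.mono (Multiset.le_add_left _ _))) hS

open scoped Classical in
theorem hasExcess_of_countP_le {F E : Multiset G} (hF : ∀ l ∈ F, l ∉ A) (hE : ∀ h ∈ E, h ∈ A)
    (hclass : ∀ l ∈ F,
      F.countP (Commute l) ≤ 2 * ((F + E).countP fun g => ¬ Commute l g))
    (h1 : F.card ≠ 1) (h3 : F.card = 3 → ∃ h ∈ E, h ∉ Subgroup.center G)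
    (hS : ProductOneFree (F + E)) : HasExcess A 0 (F + E) := by
  by_cases hmin : ∀ l ∈ F, 2 * F.countP (Commute l) ≤ F.card + 1
  · rcases hasExcess_or_of_two_mul_countP_le hA hF hmin (hS.mono (Multiset.le_add_right _ _)) with
      h | h | ⟨a, b, c, rfl, hab⟩
    · exact h.add (hasExcess_of_forall_mem hE (hS.mono (Multiset.le_add_left E F))) hS
    · exact absurd h h1
    · exact hasExcess_triple_add hA (hF a (by simp)) (hF b (by simp)) hab hE (h3 (by simp)) hS
  · push Not at hmin
    obtain ⟨l, hl, hmaj⟩ := hmin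
    exact hasExcess_of_lt_two_mul_countP hA hF hE hl (hclass l hl) hmaj hS

end Classes

section Centralizers

theorem card_mul_relIndex {G : Type*} [Group G] {H K : Subgroup G} (h : H ≤ K) :
    Nat.card H * H.relIndex K = Nat.card K := by
  rw [← Subgroup.relIndex_bot_left, ← Subgroup.relIndex_bot_left,
    Subgroup.relIndex_mul_relIndex _ _ _ bot_le h]

variable {G : Type*} [Group G] {A : Subgroup G} [IsMulCommutative A] (hA : A.index = 2)
include hA

theorem center_lt {x y : G} (hxy : ¬ Commute x y) : Subgroup.center G < A := by
  refine lt_of_le_not_ge (fun z hz => ?_) fun hAZ => hxy ?_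
  · by_contra hzA
    have hz' := Subgroup.mem_center_iff.1 hz
    exact hxy (commute_trans_of_notMem hA hzA (hz' x).symm (hz' y).symm)
  · by_cases hy : y ∈ A
    · exact Subgroup.mem_center_iff.1 (hAZ hy) x
    by_cases hx : x ∈ A
    · exact (Subgroup.mem_center_iff.1 (hAZ hx) y).symm
    have hxyA : x * y⁻¹ ∈ A := by simp [Subgroup.mul_mem_iff_of_index_two hA, hx, hy]
    have : Commute (x * y⁻¹) y := (Subgroup.mem_center_iff.1 (hAZ hxyA) y).symm
    have := this.mul_left (Commute.refl y)
    rwa [inv_mul_cancel_right] at this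

theorem commute_trans_of_notMem_center {g a b : G} (hg : g ∉ Subgroup.center G)
    (ha : Commute g a) (hb : Commute g b) : Commute a b := by
  by_cases hgA : g ∈ A
  · have hmem : ∀ c, Commute g c → c ∈ A := fun c hc => by
      by_contra hcA
      exact hg (mem_center_of_commute hA hcA hgA hc.symm)
    exact commute_of_mem (hmem a ha) (hmem b hb)
  · exact commute_trans_of_notMem hA hgA ha hb

theorem isMulCommutative_centralizer {g : G} (hg : g ∉ Subgroup.center G) :
    IsMulCommutative (Subgroup.centralizer {g}) :=
  ⟨⟨fun a b => Subtype.ext (commute_trans_of_notMem_center hA hg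
    (Subgroup.mem_centralizer_singleton_iff.1 a.2).symm
    (Subgroup.mem_centralizer_singleton_iff.1 b.2).symm)⟩⟩

theorem card_centralizer_le [Finite G] {f : G} (hf : f ∉ A) :
    Nat.card (Subgroup.centralizer {f}) ≤ 2 * Nat.card (Subgroup.center G) := by
  have hinf : A ⊓ Subgroup.centralizer {f} ≤ Subgroup.center G := fun h hh =>
    mem_center_of_commute hA hf hh.1 (Subgroup.mem_centralizer_singleton_iff.1 hh.2).symm
  have hindex : A.relIndex (Subgroup.centralizer {f}) ≤ 2 := by
    rw [← hA, ← A.relIndex_top_right]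
    exact Subgroup.relIndex_le_of_le_right le_top (by simp [hA])
  calc Nat.card (Subgroup.centralizer {f})
      = Nat.card (A ⊓ Subgroup.centralizer {f} : Subgroup G) *
          A.relIndex (Subgroup.centralizer {f}) := by
        rw [← Subgroup.inf_relIndex_right, card_mul_relIndex inf_le_right]
    _ ≤ Nat.card (Subgroup.center G) * 2 :=
        Nat.mul_le_mul (Subgroup.card_le_of_le hinf) hindex
    _ = 2 * Nat.card (Subgroup.center G) := mul_comm _ _

omit hA [IsMulCommutative A] in
theorem index_centralizer_of_index_center (hZ : (Subgroup.center G).index = 4) {g : G}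
    (hg : g ∉ Subgroup.center G) : (Subgroup.centralizer {g}).index = 2 := by
  have hmul := Subgroup.relIndex_mul_index (Subgroup.center_le_centralizer ({g} : Set G))
  rw [hZ] at hmul
  have hZC : (Subgroup.center G).relIndex (Subgroup.centralizer {g}) ≠ 1 := fun h =>
    hg (Subgroup.relIndex_eq_one.1 h (Subgroup.mem_centralizer_singleton_iff.2 rfl))
  have hC : (Subgroup.centralizer {g}).index ≠ 1 := fun h => hg (Subgroup.mem_center_iff.2 fun x =>
    Subgroup.mem_centralizer_singleton_iff.1 (Subgroup.index_eq_one.1 h ▸ Subgroup.mem_top x))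
  have hdvd : (Subgroup.centralizer {g}).index ∣ 4 := ⟨_, by rw [mul_comm, hmul]⟩
  have := Nat.le_of_dvd (by norm_num) hdvd
  interval_cases (Subgroup.centralizer {g}).index <;> omega

end Centralizers

section MaximalProductOneFree

variable {G : Type*} [Group G] [Finite G] {A : Subgroup G} [IsMulCommutative A]
  (hA : A.index = 2) {S : Multiset G} (hS : ProductOneFree S)
include hA hS

open scoped Classical in
theorem card_filter_notMem_le_one_of_countP_le (hcard : Nat.card A ≤ S.card)
    (hclass : ∀ l ∈ S, l ∉ A →
      (S.filter (· ∉ A)).countP (Commute l) ≤ 2 * S.countP fun g => ¬ Commute l g)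
    (h3 : (S.filter (· ∉ A)).card = 3 → ∃ h ∈ S, h ∈ A ∧ h ∉ Subgroup.center G) :
    (S.filter (· ∉ A)).card ≤ 1 := by
  have hsplit : S.filter (· ∉ A) + S.filter (· ∈ A) = S := by
    rw [add_comm, Multiset.filter_add_not]
  by_contra! h1
  have hexcess := hasExcess_of_countP_le hA (F := S.filter (· ∉ A)) (E := S.filter (· ∈ A))
    (fun l hl => (Multiset.mem_filter.1 hl).2) (fun h hh => (Multiset.mem_filter.1 hh).2)
    (fun l hl => by
      rw [hsplit]
      exact hclass l (Multiset.mem_filter.1 hl).1 (Multiset.mem_filter.1 hl).2)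
    (by omega)
    (fun h => by
      obtain ⟨g, hgS, hgA, hg⟩ := h3 h
      exact ⟨g, Multiset.mem_filter.2 ⟨hgS, hgA⟩, hg⟩)
    (by rwa [hsplit])
  rw [hsplit] at hexcess
  have := hexcess.card_lt
  omega

open scoped Classical in
theorem card_filter_notMem_le_one_of_three_mul_le {x y : G} (hxy : ¬ Commute x y)
    (hZ : 3 * Nat.card (Subgroup.center G) ≤ Nat.card A) (h4 : 4 ≤ Nat.card A)
    (hcard : S.card = Nat.card A) : (S.filter (· ∉ A)).card ≤ 1 := by
  refine card_filter_notMem_le_one_of_countP_le hA hS hcard.ge (fun l _ hlA => ?_) fun h3 => ?_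
  · have := isMulCommutative_centralizer hA fun hl => hlA ((center_lt hA hxy).le hl)
    have hlt := (hS.mono (Multiset.filter_le (Commute l) S)).card_lt_of_forall_mem
      (A := Subgroup.centralizer {l}) fun g hg =>
        Subgroup.mem_centralizer_singleton_iff.2 (Multiset.mem_filter.1 hg).2.symm
    have := card_centralizer_le hA hlA
    have := Multiset.countP_le_of_le (Commute l) (Multiset.filter_le (· ∉ A) S)
    have := S.card_eq_countP_add_countP (Commute l)
    rw [← Multiset.countP_eq_card_filter] at hlt
    omega
  · by_contra! hcentral
    have hlt := (hS.mono (Multiset.filter_le (· ∈ A) S)).card_lt_of_forall_mem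
      (A := Subgroup.center G) fun g hg =>
        hcentral g (Multiset.mem_filter.1 hg).1 (Multiset.mem_filter.1 hg).2
    have := congrArg Multiset.card (S.filter_add_not (· ∈ A))
    rw [Multiset.card_add] at this
    omega

open scoped Classical in
theorem exists_card_filter_notMem_le_one_of_index_center (hZ : (Subgroup.center G).index = 4)
    (hcard : S.card = Nat.card A) :
    ∃ B : Subgroup G, IsMulCommutative B ∧ B.index = 2 ∧ (S.filter (· ∉ B)).card ≤ 1 := by
  have hcardA := A.card_mul_index
  have hcardZ := (Subgroup.center G).card_mul_index
  rw [hA] at hcardA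
  rw [hZ] at hcardZ
  set N := S.filter (· ∉ Subgroup.center G) with hN
  have hN0 : N ≠ 0 := fun hN0 => by
    have := hS.card_lt_of_forall_mem (A := Subgroup.center G)
      (by simpa [hN, Multiset.filter_eq_nil] using hN0)
    omega
  obtain ⟨g, hgN, hmax⟩ := Multiset.exists_max_image (fun g => N.countP (Commute g)) hN0
  obtain ⟨hgS, hg⟩ := Multiset.mem_filter.1 hgN
  have hC : ∀ x, x ∈ Subgroup.centralizer {g} ↔ Commute g x := fun x =>
    Subgroup.mem_centralizer_singleton_iff.trans eq_comm
  have := isMulCommutative_centralizer hA hg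
  have hB := index_centralizer_of_index_center hZ hg
  refine ⟨_, this, hB, card_filter_notMem_le_one_of_countP_le hB hS ?_ (fun l hl hlB => ?_)
    fun _ => ⟨g, hgS, (hC g).2 (Commute.refl g), hg⟩⟩
  · have := (Subgroup.centralizer {g}).card_mul_index
    rw [hB] at this
    omega
  · have hdisj := countP_add_countP_le_card fun y (hy : y ∈ N) (hgy : Commute g y)
      (hly : Commute l y) => hlB ((hC l).2 (commute_trans_of_notMem_center hA
        (Multiset.mem_filter.1 hy).2 hgy.symm hly.symm))
    have h1 : (S.filter (· ∉ Subgroup.centralizer {g})).countP (Commute l) ≤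
        N.countP (Commute l) :=
      Multiset.countP_le_of_le _ (Multiset.monotone_filter_right S fun x hx hxZ =>
        hx (Subgroup.center_le_centralizer _ hxZ))
    have h2 := hmax l (Multiset.mem_filter.2 ⟨hl, fun hlZ =>
      hlB (Subgroup.center_le_centralizer _ hlZ)⟩)
    have h3 := N.card_eq_countP_add_countP (Commute l)
    have h4 := Multiset.countP_le_of_le (fun y => ¬ Commute l y)
      (hN ▸ Multiset.filter_le _ S : N ≤ S)
    omega

open scoped Classical in
theorem exists_card_filter_notMem_le_one {x y : G} (hxy : ¬ Commute x y) (h4 : 4 ≤ Nat.card A)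
    (hcard : S.card = Nat.card A) :
    ∃ B : Subgroup G, IsMulCommutative B ∧ B.index = 2 ∧ (S.filter (· ∉ B)).card ≤ 1 := by
  have hlt := center_lt hA hxy
  by_cases hZ : 3 * Nat.card (Subgroup.center G) ≤ Nat.card A
  · exact ⟨A, ‹_›, hA, card_filter_notMem_le_one_of_three_mul_le hA hS hxy hZ h4 hcard⟩
  refine exists_card_filter_notMem_le_one_of_index_center hA hS ?_ hcard
  have hmul := Subgroup.relIndex_mul_index hlt.le
  have hne : (Subgroup.center G).relIndex A ≠ 1 := fun h =>
    hlt.not_ge (Subgroup.relIndex_eq_one.1 h)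
  have hcardA := card_mul_relIndex hlt.le
  have hpos : 0 < Nat.card A := by omega
  have : (Subgroup.center G).relIndex A < 3 := by
    by_contra! h
    rw [← hcardA, mul_comm] at hZ
    exact hZ (Nat.mul_le_mul_left _ h)
  have : (Subgroup.center G).relIndex A ≠ 0 := by
    rintro h
    rw [h] at hcardA
    omega
  rw [← hmul, hA]
  omega

end MaximalProductOneFree

section Inverse

variable {G : Type*} [Group G]

theorem ProductOneFree.lt_orderOf {k : ℕ} {β : G} (h : ProductOneFree (Multiset.replicate k β))
    (hβ : orderOf β ≠ 0) : k < orderOf β := by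
  by_contra! hle
  refine h (List.replicate (orderOf β) β) (by simpa using hβ) ?_ (by simp [pow_orderOf_eq_one])
  rwa [Multiset.coe_replicate, Multiset.replicate_le_replicate]

theorem productOneFree_replicate_add_singleton {β γ : G} (hγ : γ ∉ Subgroup.zpowers β) :
    ProductOneFree (Multiset.replicate (orderOf β - 1) β + {γ}) := by
  intro l hl0 hl hl1
  rw [add_comm, Multiset.singleton_add] at hl
  by_cases hγl : γ ∈ l
  · obtain ⟨l₁, l₂, rfl⟩ := List.append_of_mem hγl
    rw [← Multiset.coe_add, ← Multiset.cons_coe, Multiset.add_cons, Multiset.cons_le_cons_iff] at hl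
    have hβ : ∀ g ∈ (l₁ : Multiset G) + l₂, g ∈ Subgroup.zpowers β := fun g hg => by
      rw [Multiset.eq_of_mem_replicate (Multiset.mem_of_le hl hg)]
      exact Subgroup.mem_zpowers β
    have h₁ : l₁.prod ∈ Subgroup.zpowers β :=
      Subgroup.list_prod_mem _ fun g hg => hβ g (by simp [hg])
    have h₂ : l₂.prod ∈ Subgroup.zpowers β :=
      Subgroup.list_prod_mem _ fun g hg => hβ g (by simp [hg])
    rw [List.prod_append, List.prod_cons] at hl1
    have hone := Subgroup.one_mem (Subgroup.zpowers β)
    rw [← hl1, Subgroup.mul_mem_cancel_left _ h₁, Subgroup.mul_mem_cancel_right _ h₂] at hone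
    exact hγ hone
  · rw [Multiset.le_cons_of_notMem (by simpa using hγl)] at hl
    have hlβ : l = List.replicate l.length β := List.eq_replicate_of_mem fun b hb =>
      Multiset.eq_of_mem_replicate (Multiset.mem_of_le hl (Multiset.mem_coe.2 hb))
    have hlen : l.length ≤ orderOf β - 1 := by simpa using Multiset.card_le_card hl
    rw [hlβ, List.prod_replicate] at hl1
    have hpos := List.length_pos_iff.2 hl0
    have := Nat.le_of_dvd hpos (orderOf_dvd_of_pow_eq_one hl1)
    omega

variable {A : Subgroup G}

theorem orderOf_eq_card_of_productOneFree_replicate [Finite A] {β : G} (hβ : β ∈ A)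
    (h : ProductOneFree (Multiset.replicate (Nat.card A - 1) β)) : orderOf β = Nat.card A := by
  have hdvd : orderOf β ∣ Nat.card A := A.orderOf_dvd_natCard hβ
  have hpos : 0 < orderOf β := Nat.pos_of_dvd_of_pos hdvd Nat.card_pos
  have := h.lt_orderOf hpos.ne'
  have := Nat.le_of_dvd Nat.card_pos hdvd
  omega

variable [IsMulCommutative A]

theorem ProductOneFree.eq_replicate_of_forall_mem [Finite A] {T : Multiset G}
    (hS : ProductOneFree T) (hT : ∀ g ∈ T, g ∈ A) (hcard : T.card + 1 = Nat.card A) {β : G}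
    (hβ : β ∈ T) : T = Multiset.replicate (Nat.card A - 1) β ∧ orderOf β = Nat.card A := by
  have hrep : T = Multiset.replicate (Nat.card A - 1) β := by
    refine Multiset.eq_replicate.2 ⟨by omega, fun g hg => by_contra fun hne => ?_⟩
    obtain ⟨T, rfl⟩ := Multiset.exists_cons_of_mem hβ
    obtain ⟨T, rfl⟩ := Multiset.exists_cons_of_mem ((Multiset.mem_cons.1 hg).resolve_left hne)
    have hsplit : β ::ₘ g ::ₘ T = {β, g} + T := by simp
    rw [hsplit] at hS
    simp only [Multiset.forall_mem_cons, Multiset.card_cons] at hT hcard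
    have hexcess := (hasExcess_pair_of_ne hT.1 hT.2.1 (Ne.symm hne)
      (hS.mono (Multiset.le_add_right _ _))).add
      (hasExcess_of_forall_mem hT.2.2 (hS.mono (Multiset.le_add_left _ _))) hS
    have := hexcess.card_lt
    rw [← hsplit, Multiset.card_cons, Multiset.card_cons] at this
    omega
  exact ⟨hrep, orderOf_eq_card_of_productOneFree_replicate (hT β hβ) (hrep ▸ hS)⟩

theorem ProductOneFree.exists_eq_replicate_add [Finite G] (hA : A.index = 2) {S : Multiset G}
    (hS : ProductOneFree S) {x y : G} (hxy : ¬ Commute x y) (h4 : 4 ≤ Nat.card A)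
    (hcard : S.card = Nat.card A) :
    ∃ β γ, S = Multiset.replicate (Nat.card A - 1) β + {γ} ∧ orderOf β = Nat.card A ∧
      γ ∉ Subgroup.zpowers β := by
  classical
  obtain ⟨B, _, hB, hle⟩ := exists_card_filter_notMem_le_one hA hS hxy h4 hcard
  have hBA : Nat.card B = Nat.card A := by
    have h1 := A.card_mul_index
    have h2 := B.card_mul_index
    rw [hA] at h1
    rw [hB] at h2
    omega
  have hsplit := S.filter_add_not (· ∈ B)
  have hcard' := congrArg Multiset.card hsplit
  rw [Multiset.card_add] at hcard'
  have hSB : ∀ g ∈ S.filter (· ∈ B), g ∈ B := fun g hg => (Multiset.mem_filter.1 hg).2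
  have hfree := hS.mono (Multiset.filter_le (· ∈ B) S)
  have hlt := hfree.card_lt_of_forall_mem hSB
  obtain ⟨γ, hγ⟩ := Multiset.card_eq_one.1 (show (S.filter (· ∉ B)).card = 1 by omega)
  obtain ⟨β, hβ⟩ := Multiset.card_pos_iff_exists_mem.1 (show 0 < (S.filter (· ∈ B)).card by omega)
  obtain ⟨hrep, horder⟩ := hfree.eq_replicate_of_forall_mem hSB (by omega) hβ
  have hzpowers : Subgroup.zpowers β = B := Subgroup.eq_of_le_of_card_ge
    (Subgroup.zpowers_le.2 (hSB β hβ)) (by rw [Nat.card_zpowers, horder])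
  have hγB : γ ∈ S.filter (· ∉ B) := hγ ▸ Multiset.mem_singleton_self γ
  refine ⟨β, γ, ?_, horder.trans hBA, hzpowers ▸ (Multiset.mem_filter.1 hγB).2⟩
  rw [← hBA, ← hrep, ← hγ, hsplit]

theorem ProductOneFree.count_eq_or_count_le_one [Finite G] [DecidableEq G] (hA : A.index = 2)
    {S : Multiset G} (hS : ProductOneFree S) {x y : G} (hxy : ¬ Commute x y) (h4 : 4 ≤ Nat.card A)
    (hcard : S.card = Nat.card A) (g : G) : S.count g = Nat.card A - 1 ∨ S.count g ≤ 1 := by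
  obtain ⟨β, γ, rfl, -, hγ⟩ := hS.exists_eq_replicate_add hA hxy h4 hcard
  have hγβ : γ ≠ β := fun h => hγ (h ▸ Subgroup.mem_zpowers γ)
  rw [Multiset.count_add, Multiset.count_replicate, Multiset.count_singleton]
  grind

theorem card_le_of_forall_productOneFree [Finite G] (hA : A.index = 2) {S : Multiset G}
    (hS : ∀ T ≤ S, T.card = Nat.card A → ProductOneFree T) {x y : G} (hxy : ¬ Commute x y)
    (h4 : 4 ≤ Nat.card A) : S.card ≤ Nat.card A := by
  classical
  have hcount := fun T hTS hT => (hS T hTS hT).count_eq_or_count_le_one hA hxy h4 hT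
  by_contra! hlt
  obtain ⟨U, R, rfl, hU⟩ := exists_eq_add_of_le_card hlt.le
  obtain ⟨g, R, rfl⟩ := exists_eq_singleton_add (show 1 ≤ R.card by
    rw [Multiset.card_add] at hlt
    omega)
  obtain ⟨β, γ, rfl, -, hγ⟩ :=
    (hS U (Multiset.le_add_right _ _) hU).exists_eq_replicate_add hA hxy h4 hU
  have hβγ : β ≠ γ := fun h => hγ (h ▸ Subgroup.mem_zpowers β)
  rw [← add_assoc] at hcount
  by_cases hgβ : g = β
  · have hle : Multiset.replicate (Nat.card A - 1) β + {g} ≤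
        Multiset.replicate (Nat.card A - 1) β + {γ} + {g} + R :=
      (add_le_add_left (Multiset.le_add_right _ _) _).trans (Multiset.le_add_right _ _)
    have := hcount _ hle (by simpa using hU) β
    simp only [hgβ, Multiset.count_add, Multiset.count_replicate_self,
      Multiset.count_singleton_self] at this
    omega
  · have hle : Multiset.replicate (Nat.card A - 2) β + {γ} + {g} ≤
        Multiset.replicate (Nat.card A - 1) β + {γ} + {g} + R :=
      le_add_right (by gcongr; omega)
    have := hcount _ hle (by
      simp only [Multiset.card_add, Multiset.card_replicate, Multiset.card_singleton]
      omega) β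
    simp only [Multiset.count_add, Multiset.count_replicate_self, Multiset.count_singleton,
      hβγ, Ne.symm hgβ, if_false] at this
    omega

end Inverse

section Presentation

theorem zpow_mul_of_relation {G : Type*} [Group G] {α β : G} {s : ℤ} (h : β * α = α * β ^ s)
    (i : ℤ) : β ^ i * α = α * β ^ (s * i) := by
  have h1 : SemiconjBy α (β ^ s) β := h.symm
  rw [zpow_mul, (h1.zpow_right i).eq]

/-- The homomorphism from the presented group given by elements satisfying the relations. -/
def presentedLift {G : Type*} [Group G] {n : ℕ} {s : ℤ} (α β : G) (hα : α ^ 2 = 1)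
    (hβ : β ^ n = 1) (h : β * α = α * β ^ s) : Gns n s →* G :=
  PresentedGroup.toGroup (f := ![α, β]) (rels := relators n s) (by
    intro r hr
    rcases hr with rfl | rfl | rfl
    · simpa using hα
    · simpa using hβ
    · simp [h])

section Generators

variable (n : ℕ) (s : ℤ)

/-- The generator `x` of `G_{n,s}`, with index `0` in the presentation. -/
def genX : Gns n s := PresentedGroup.of 0

/-- The generator `y` of `G_{n,s}`, with index `1` in the presentation. -/
def genY : Gns n s := PresentedGroup.of 1

theorem genX_sq : genX n s ^ 2 = 1 :=
  PresentedGroup.one_of_mem (rels := relators n s) (x := FreeGroup.of 0 ^ 2) (by simp [relators])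

theorem genY_pow : genY n s ^ n = 1 :=
  PresentedGroup.one_of_mem (rels := relators n s) (x := FreeGroup.of 1 ^ n) (by simp [relators])

theorem genY_mul_genX : genY n s * genX n s = genX n s * genY n s ^ s :=
  mul_inv_eq_one.1 (PresentedGroup.one_of_mem (rels := relators n s)
    (x := (FreeGroup.of 1 * FreeGroup.of 0) * (FreeGroup.of 0 * FreeGroup.of 1 ^ s)⁻¹)
    (by simp [relators]))

variable {n s}

theorem genX_mul_self : genX n s * genX n s = 1 := by rw [← pow_two, genX_sq]

theorem genY_zpow_mul_genX (i : ℤ) :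
    genY n s ^ i * genX n s = genX n s * genY n s ^ (s * i) :=
  zpow_mul_of_relation (genY_mul_genX n s) i

theorem genX_mul_zpow_mul_zpow (i j : ℤ) :
    genX n s * genY n s ^ i * genY n s ^ j = genX n s * genY n s ^ (i + j) := by
  rw [mul_assoc, ← zpow_add]

theorem zpow_mul_genX_mul_zpow (i j : ℤ) :
    genY n s ^ i * (genX n s * genY n s ^ j) = genX n s * genY n s ^ (s * i + j) := by
  rw [← mul_assoc, genY_zpow_mul_genX, genX_mul_zpow_mul_zpow]

theorem genX_mul_zpow_mul_genX_mul_zpow (i j : ℤ) :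
    genX n s * genY n s ^ i * (genX n s * genY n s ^ j) = genY n s ^ (s * i + j) := by
  rw [mul_assoc, zpow_mul_genX_mul_zpow, ← mul_assoc, genX_mul_self, one_mul]

theorem exists_eq_zpow_or_genX_mul_zpow (g : Gns n s) :
    ∃ i : ℤ, g = genY n s ^ i ∨ g = genX n s * genY n s ^ i := by
  have hg : g ∈ Subgroup.closure (Set.range (PresentedGroup.of : Fin 2 → Gns n s)) := by
    rw [PresentedGroup.closure_range_of]
    trivial
  induction hg using Subgroup.closure_induction with
  | mem g hg =>
    obtain ⟨k, rfl⟩ := hg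
    fin_cases k
    · exact ⟨0, Or.inr (by simp [genX])⟩
    · exact ⟨1, Or.inl (by simp [genY])⟩
  | one => exact ⟨0, Or.inl (by simp)⟩
  | mul a b _ _ ha hb =>
    obtain ⟨i, rfl | rfl⟩ := ha <;> obtain ⟨j, rfl | rfl⟩ := hb
    · exact ⟨i + j, Or.inl (zpow_add _ _ _).symm⟩
    · exact ⟨_, Or.inr (zpow_mul_genX_mul_zpow i j)⟩
    · exact ⟨_, Or.inr (genX_mul_zpow_mul_zpow i j)⟩
    · exact ⟨_, Or.inl (genX_mul_zpow_mul_genX_mul_zpow i j)⟩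
  | inv a _ ha =>
    obtain ⟨i, rfl | rfl⟩ := ha
    · exact ⟨-i, Or.inl (zpow_neg _ _).symm⟩
    · refine ⟨-(s * i), Or.inr (inv_eq_of_mul_eq_one_right ?_)⟩
      rw [genX_mul_zpow_mul_genX_mul_zpow, add_neg_cancel, zpow_zero]

theorem finite_Gns (hn : 0 < n) : Finite (Gns n s) := by
  have hfin : Finite (Subgroup.zpowers (genY n s)) :=
    (isOfFinOrder_iff_pow_eq_one.2 ⟨n, hn, genY_pow n s⟩).finite_zpowers
  refine Finite.of_surjective
    (fun p : Bool × Subgroup.zpowers (genY n s) => bif p.1 then (p.2 : Gns n s) else genX n s * p.2)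
    fun g => ?_
  obtain ⟨i, rfl | rfl⟩ := exists_eq_zpow_or_genX_mul_zpow g
  · exact ⟨(true, ⟨_, Subgroup.zpow_mem_zpowers _ i⟩), rfl⟩
  · exact ⟨(false, ⟨_, Subgroup.zpow_mem_zpowers _ i⟩), rfl⟩

end Generators

end Presentation

section Structure

variable {n : ℕ} {s : ℤ}

/-- The action of `G_{n,s}` on `ℤ/n` in which `x` is the multiplication by `s` and `y` the
translation by `1`; it detects the order of `y`. -/
noncomputable def affineRep (hs : s ^ 2 ≡ 1 [ZMOD n]) : Gns n s →* Equiv.Perm (ZMod n) :=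
  have hs' : (s : ZMod n) * s = 1 := by
    have := (ZMod.intCast_eq_intCast_iff _ _ n).2 hs
    push_cast at this
    rw [← this, sq]
  presentedLift
    ⟨fun z : ZMod n => s * z, fun z : ZMod n => s * z,
      fun z => by simp [← mul_assoc, hs'], fun z => by simp [← mul_assoc, hs']⟩
    (Equiv.addRight (1 : ZMod n))
    (by ext z; simp [sq, ← mul_assoc, hs'])
    (by ext z; simp)
    (by ext z; simp [mul_add, hs'])

theorem affineRep_genY_zpow (hs : s ^ 2 ≡ 1 [ZMOD n]) (i : ℤ) (z : ZMod n) :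
    affineRep hs (genY n s ^ i) z = z + i := by
  simp [affineRep, presentedLift, genY]

theorem affineRep_genX (hs : s ^ 2 ≡ 1 [ZMOD n]) (z : ZMod n) :
    affineRep hs (genX n s) z = s * z := by
  simp [affineRep, presentedLift, genX]

theorem genY_zpow_eq_one_iff (hs : s ^ 2 ≡ 1 [ZMOD n]) {i : ℤ} :
    genY n s ^ i = 1 ↔ (n : ℤ) ∣ i := by
  constructor
  · intro h
    have := affineRep_genY_zpow hs i 0
    rw [h] at this
    rw [← ZMod.intCast_zmod_eq_zero_iff_dvd]
    simpa using this.symm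
  · rintro ⟨k, rfl⟩
    rw [zpow_mul, zpow_natCast, genY_pow, one_zpow]

theorem orderOf_genY (hs : s ^ 2 ≡ 1 [ZMOD n]) : orderOf (genY n s) = n :=
  Nat.dvd_antisymm (orderOf_dvd_of_pow_eq_one (genY_pow n s)) <| by
    rw [← Int.natCast_dvd_natCast, ← genY_zpow_eq_one_iff hs, zpow_natCast, pow_orderOf_eq_one]

theorem card_zpowers_genY (hs : s ^ 2 ≡ 1 [ZMOD n]) :
    Nat.card (Subgroup.zpowers (genY n s)) = n := by
  rw [Nat.card_zpowers, orderOf_genY hs]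

theorem genX_notMem_zpowers (hs : s ^ 2 ≡ 1 [ZMOD n]) (hs1 : ¬ s ≡ 1 [ZMOD n]) :
    genX n s ∉ Subgroup.zpowers (genY n s) := by
  rintro ⟨i, hi : genY n s ^ i = genX n s⟩
  have h0 := affineRep_genX hs 0
  have h1 := affineRep_genX hs 1
  rw [← hi, affineRep_genY_zpow] at h0 h1
  rw [zero_add, mul_zero] at h0
  rw [h0, add_zero, mul_one] at h1
  exact hs1 ((ZMod.intCast_eq_intCast_iff _ _ n).1 (by simpa using h1.symm))

theorem not_commute_genX_genY (hs : s ^ 2 ≡ 1 [ZMOD n]) (hs1 : ¬ s ≡ 1 [ZMOD n]) :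
    ¬ Commute (genX n s) (genY n s) := fun h => by
  have hpow : genY n s ^ (s - 1) = 1 := by
    rw [zpow_sub_one, ← mul_left_cancel (h.eq.trans (genY_mul_genX n s)), mul_inv_cancel]
  exact hs1 (Int.modEq_iff_dvd.2 ((genY_zpow_eq_one_iff hs).1 hpow)).symm

theorem index_zpowers_genY (hs : s ^ 2 ≡ 1 [ZMOD n]) (hs1 : ¬ s ≡ 1 [ZMOD n]) :
    (Subgroup.zpowers (genY n s)).index = 2 := by
  refine Subgroup.index_eq_two_iff_exists_notMem_and'.2
    ⟨genX n s, genX_notMem_zpowers hs hs1, fun g => ?_⟩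
  obtain ⟨i, rfl | rfl⟩ := exists_eq_zpow_or_genX_mul_zpow g
  · exact Or.inr ⟨i, rfl⟩
  · exact Or.inl ⟨i, by rw [← mul_assoc, genX_mul_self, one_mul]⟩

theorem index_zpowers_eq_two (hn : 0 < n) (hs : s ^ 2 ≡ 1 [ZMOD n]) (hs1 : ¬ s ≡ 1 [ZMOD n])
    {β : Gns n s} (hβ : orderOf β = n) : (Subgroup.zpowers β).index = 2 := by
  have hy := (Subgroup.zpowers (genY n s)).card_mul_index
  rw [index_zpowers_genY hs hs1, ← (Subgroup.zpowers β).card_mul_index, Nat.card_zpowers,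
    Nat.card_zpowers, orderOf_genY hs, hβ] at hy
  exact (Nat.eq_of_mul_eq_mul_left hn hy).symm

theorem isPresentedBy_of_relations (hn : 0 < n) {α β : Gns n s}
    (hα : α ^ 2 = 1) (h : β * α = α * β ^ s) (hβ : orderOf β = n)
    (hαβ : α ∉ Subgroup.zpowers β) : IsPresentedBy n s α β := by
  have hβn : β ^ n = 1 := orderOf_dvd_iff_pow_eq_one.1 hβ.dvd
  let f : Gns n s →* Gns n s := presentedLift α β hα hβn h
  have hfX : f (genX n s) = α := by simp [f, presentedLift, genX]
  have hfY : f (genY n s) = β := by simp [f, presentedLift, genY]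
  have hinj : Function.Injective f := by
    rw [injective_iff_map_eq_one]
    intro g hg
    obtain ⟨i, rfl | rfl⟩ := exists_eq_zpow_or_genX_mul_zpow g
    · rw [map_zpow, hfY, ← orderOf_dvd_iff_zpow_eq_one, hβ] at hg
      obtain ⟨k, rfl⟩ := hg
      rw [zpow_mul, zpow_natCast, genY_pow, one_zpow]
    · rw [map_mul, map_zpow, hfX, hfY] at hg
      exact absurd ⟨-i, by simpa using (eq_inv_of_mul_eq_one_left hg).symm⟩ hαβ
  have := finite_Gns (s := s) hn
  exact ⟨MulEquiv.ofBijective f (Finite.injective_iff_bijective.1 hinj), hfX, hfY⟩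

theorem genY_sq_mem_center (hn : 0 < n) (hs : s ^ 2 ≡ 1 [ZMOD n]) (hs1 : ¬ s ≡ 1 [ZMOD n])
    {β : Gns n s} (hβ : orderOf β = n) (hβY : β ∉ Subgroup.zpowers (genY n s)) :
    genY n s ^ 2 ∈ Subgroup.center (Gns n s) := by
  have hmem := Subgroup.sq_mem_of_index_two (index_zpowers_eq_two hn hs hs1 hβ) (genY n s)
  exact mem_center_of_commute (index_zpowers_genY hs hs1) hβY
    (Subgroup.pow_mem _ (Subgroup.mem_zpowers _) 2)
    (commute_of_mem (Subgroup.mem_zpowers β) hmem)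

theorem dvd_two_mul_sub_one (hs : s ^ 2 ≡ 1 [ZMOD n])
    (h : genY n s ^ 2 ∈ Subgroup.center (Gns n s)) : (n : ℤ) ∣ 2 * (s - 1) := by
  have h1 := Subgroup.mem_center_iff.1 h (genX n s)
  rw [← zpow_ofNat, genY_zpow_mul_genX, mul_right_inj] at h1
  rw [← genY_zpow_eq_one_iff hs, show 2 * (s - 1) = s * 2 - 2 by ring, zpow_sub, ← h1,
    mul_inv_cancel]

theorem eq_of_mem_zpowers_of_sq_eq_one {G : Type*} [Group G] {g a b : G}
    (ha : a ∈ Subgroup.zpowers g) (hb : b ∈ Subgroup.zpowers g) (ha2 : a ^ 2 = 1) (hb2 : b ^ 2 = 1)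
    (ha1 : a ≠ 1) (hb1 : b ≠ 1) : a = b := by
  obtain ⟨i, rfl⟩ := ha
  obtain ⟨j, rfl⟩ := hb
  simp only [ne_eq, ← zpow_natCast, ← zpow_mul, ← orderOf_dvd_iff_zpow_eq_one] at ha2 hb2 ha1 hb1 ⊢
  rw [zpow_eq_zpow_iff_modEq, Int.modEq_iff_dvd]
  obtain ⟨k, hk⟩ := ha2
  obtain ⟨l, hl⟩ := hb2
  have hodd : ∀ {i k : ℤ}, i * 2 = orderOf g * k → ¬ (orderOf g : ℤ) ∣ i → Odd k :=
    fun hk hi => by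
      by_contra heven
      obtain ⟨m, rfl⟩ := Int.not_odd_iff_even.1 heven
      exact hi ⟨m, by linarith⟩
  obtain ⟨m, hm⟩ := (hodd hl hb1).sub_odd (hodd hk ha1)
  exact ⟨m, mul_left_cancel₀ two_ne_zero (by
    push_cast at hk hl
    linear_combination hl - hk + orderOf g * hm)⟩

theorem zpow_sub_one_ne_one (hs1 : ¬ s ≡ 1 [ZMOD n]) {g : Gns n s} (hg : orderOf g = n) :
    g ^ (s - 1) ≠ 1 := fun h =>
  hs1 (Int.modEq_iff_dvd.2 (hg ▸ orderOf_dvd_iff_zpow_eq_one.2 h)).symm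

theorem zpow_sub_one_sq (h : (n : ℤ) ∣ 2 * (s - 1)) {g : Gns n s} (hg : orderOf g = n) :
    (g ^ (s - 1)) ^ 2 = 1 := by
  rwa [← zpow_natCast, ← zpow_mul, mul_comm, ← orderOf_dvd_iff_zpow_eq_one, hg]

theorem even_sub_one (hs : s ^ 2 ≡ 1 [ZMOD n]) (hs1 : ¬ s ≡ 1 [ZMOD n])
    (h : (n : ℤ) ∣ 2 * (s - 1)) : Even (s - 1) := by
  have hn : Even (n : ℤ) := by
    by_contra hodd
    exact hs1 (Int.modEq_iff_dvd.2 ((Int.isCoprime_two_right.2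
      (Int.not_even_iff_odd.1 hodd)).dvd_of_dvd_mul_left h)).symm
  have hsq : Even (s ^ 2 - 1) := even_iff_two_dvd.2 (hn.two_dvd.trans hs.symm.dvd)
  simpa only [Int.even_sub_one, Int.even_pow' two_ne_zero] using hsq

theorem genY_zpow_mem_zpowers_of_even {β : Gns n s} (hβ : (Subgroup.zpowers β).index = 2) {i : ℤ}
    (hi : Even i) : genY n s ^ i ∈ Subgroup.zpowers β := by
  obtain ⟨j, rfl⟩ := hi.two_dvd
  rw [zpow_mul, zpow_ofNat]
  exact Subgroup.zpow_mem _ (Subgroup.sq_mem_of_index_two hβ _) j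

theorem eq_genY_zpow_of_sq_eq_one (hs : s ^ 2 ≡ 1 [ZMOD n]) (hs1 : ¬ s ≡ 1 [ZMOD n])
    (hdvd : (n : ℤ) ∣ 2 * (s - 1)) {β g : Gns n s} (hβ : (Subgroup.zpowers β).index = 2)
    (hg : g ∈ Subgroup.zpowers β) (hg2 : g ^ 2 = 1) (hg1 : g ≠ 1) : g = genY n s ^ (s - 1) :=
  eq_of_mem_zpowers_of_sq_eq_one hg
    (genY_zpow_mem_zpowers_of_even hβ (even_sub_one hs hs1 hdvd)) hg2
    (zpow_sub_one_sq hdvd (orderOf_genY hs)) hg1 (zpow_sub_one_ne_one hs1 (orderOf_genY hs))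

theorem isPresentedBy_genX_of_notMem (hn : 0 < n) (hs : s ^ 2 ≡ 1 [ZMOD n])
    (hs1 : ¬ s ≡ 1 [ZMOD n]) {β : Gns n s} (hβ : orderOf β = n)
    (hβY : β ∉ Subgroup.zpowers (genY n s)) : IsPresentedBy n s (genX n s) β := by
  have hindex := index_zpowers_eq_two hn hs hs1 hβ
  have hdvd := dvd_two_mul_sub_one hs (genY_sq_mem_center hn hs hs1 hβ hβY)
  have hX : genX n s ∉ Subgroup.zpowers β := fun h =>
    genX_notMem_zpowers hs hs1 ⟨s - 1, (eq_genY_zpow_of_sq_eq_one hs hs1 hdvd hindex h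
      (genX_sq n s) fun h1 => genX_notMem_zpowers hs hs1 (h1 ▸ Subgroup.one_mem _)).symm⟩
  have hβpow : β ^ (s - 1) = genY n s ^ (s - 1) :=
    eq_genY_zpow_of_sq_eq_one hs hs1 hdvd hindex (Subgroup.zpow_mem_zpowers β _)
      (zpow_sub_one_sq hdvd hβ) (zpow_sub_one_ne_one hs1 hβ)
  refine isPresentedBy_of_relations hn (genX_sq n s) ?_ hβ hX
  obtain ⟨i, rfl | rfl⟩ := exists_eq_zpow_or_genX_mul_zpow β
  · exact absurd (Subgroup.zpow_mem_zpowers _ i) hβY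
  have hi : Odd i := by
    by_contra heven
    exact hX ((Subgroup.mul_mem_cancel_right _ (genY_zpow_mem_zpowers_of_even hindex
      (Int.not_odd_iff_even.1 heven))).1
      (Subgroup.mem_zpowers _))
  obtain ⟨j, rfl⟩ := hi
  have hpow : genY n s ^ (s * (2 * j + 1)) = genY n s ^ (2 * j + 1 + (s - 1)) := by
    rw [← mul_inv_eq_one, ← zpow_neg, ← zpow_add, genY_zpow_eq_one_iff hs]
    exact (hdvd.mul_right j).trans (dvd_of_eq (by ring))
  calc genX n s * genY n s ^ (2 * j + 1) * genX n s
      = genY n s ^ (2 * j + 1 + (s - 1)) := by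
        rw [mul_assoc, genY_zpow_mul_genX, ← mul_assoc, genX_mul_self, one_mul, hpow]
    _ = genX n s * (genX n s * genY n s ^ (2 * j + 1) * genY n s ^ (s - 1)) := by
        rw [genX_mul_zpow_mul_zpow, ← mul_assoc, genX_mul_self, one_mul]
    _ = genX n s * (genX n s * genY n s ^ (2 * j + 1)) ^ s := by
        rw [← hβpow, mul_self_zpow, sub_add_cancel]

theorem isPresentedBy_genX (hn : 0 < n) (hs : s ^ 2 ≡ 1 [ZMOD n]) (hs1 : ¬ s ≡ 1 [ZMOD n])
    {β : Gns n s} (hβ : orderOf β = n) : IsPresentedBy n s (genX n s) β := by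
  by_cases hβY : β ∈ Subgroup.zpowers (genY n s)
  · refine isPresentedBy_of_relations hn (genX_sq n s) ?_ hβ fun h =>
      genX_notMem_zpowers hs hs1 (Subgroup.zpowers_le.2 hβY h)
    obtain ⟨i, rfl⟩ := hβY
    beta_reduce
    rw [genY_zpow_mul_genX, ← zpow_mul, mul_comm]
  · exact isPresentedBy_genX_of_notMem hn hs hs1 hβ hβY

end Structure

section Extremal

theorem ProductOneFree.not_hasShortProductOneSubseq {G : Type*} [Group G] {S : Multiset G}
    (hS : ProductOneFree S) : ¬ HasShortProductOneSubseq S := by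
  rintro ⟨T, hT, ⟨l, rfl, hl⟩, hcard, -⟩
  refine hS l ?_ hT hl
  rintro rfl
  simp at hcard

theorem hasShortProductOneSubseq_of_not_productOneFree {G : Type*} [Group G] {S : Multiset G}
    (hcard : S.card ≤ Monoid.exponent G) (hS : ¬ ProductOneFree S) :
    HasShortProductOneSubseq S := by
  unfold ProductOneFree at hS
  push Not at hS
  obtain ⟨l, hl0, hl, hl1⟩ := hS
  exact ⟨l, hl, ⟨l, rfl, hl1⟩, List.length_pos_iff.2 hl0, (Multiset.card_le_card hl).trans hcard⟩

variable {n : ℕ} {s : ℤ}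

theorem le_exponent (hn : 0 < n) (hs : s ^ 2 ≡ 1 [ZMOD n]) : n ≤ Monoid.exponent (Gns n s) := by
  have := finite_Gns (s := s) hn
  have hdvd := Monoid.order_dvd_exponent (genY n s)
  rw [orderOf_genY hs] at hdvd
  exact Nat.le_of_dvd (Nat.pos_of_ne_zero Monoid.exponent_ne_zero_of_finite) hdvd

theorem IsPresentedBy.orderOf_eq {α β : Gns n s} (h : IsPresentedBy n s α β)
    (hs : s ^ 2 ≡ 1 [ZMOD n]) : orderOf β = n := by
  obtain ⟨e, rfl, rfl⟩ := h
  exact (MulEquiv.orderOf_eq e (genY n s)).trans (orderOf_genY hs)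

theorem IsPresentedBy.notMem_zpowers {α β : Gns n s} (h : IsPresentedBy n s α β)
    (hs : s ^ 2 ≡ 1 [ZMOD n]) (hs1 : ¬ s ≡ 1 [ZMOD n]) : α ∉ Subgroup.zpowers β := by
  obtain ⟨e, rfl, rfl⟩ := h
  rintro ⟨i, hi⟩
  exact genX_notMem_zpowers hs hs1 ⟨i, e.injective ((map_zpow e _ i).trans hi)⟩

theorem IsPresentedBy.productOneFree {α β : Gns n s} (h : IsPresentedBy n s α β)
    (hs : s ^ 2 ≡ 1 [ZMOD n]) (hs1 : ¬ s ≡ 1 [ZMOD n]) (t : ℕ) :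
    ProductOneFree (Multiset.replicate (n - 1) β + {α * β ^ t}) := by
  have hmem := Subgroup.pow_mem _ (Subgroup.mem_zpowers β) t
  have hγ : α * β ^ t ∉ Subgroup.zpowers β := fun hγ =>
    h.notMem_zpowers hs hs1 ((Subgroup.mul_mem_cancel_right _ hmem).1 hγ)
  have hfree := productOneFree_replicate_add_singleton hγ
  rwa [h.orderOf_eq hs] at hfree

theorem ProductOneFree.exists_isPresentedBy (hn : 4 ≤ n) (hs : s ^ 2 ≡ 1 [ZMOD n])
    (hs1 : ¬ s ≡ 1 [ZMOD n]) {S : Multiset (Gns n s)} (hS : ProductOneFree S) (hcard : S.card = n) :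
    ∃ α β : Gns n s, IsPresentedBy n s α β ∧
      ∃ t : ℕ, t ≤ n - 1 ∧ S = Multiset.replicate (n - 1) β + {α * β ^ t} := by
  classical
  have := finite_Gns (s := s) (by omega : 0 < n)
  have hY := card_zpowers_genY hs
  obtain ⟨β, γ, rfl, hβ, hγ⟩ := hS.exists_eq_replicate_add (index_zpowers_genY hs hs1)
    (not_commute_genX_genY hs hs1) (hn.trans_eq hY.symm) (hcard.trans hY.symm)
  rw [hY] at hβ ⊢
  have h := isPresentedBy_genX (by omega) hs hs1 hβ
  have hmem : (genX n s)⁻¹ * γ ∈ Subgroup.zpowers β := by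
    simp [Subgroup.mul_mem_iff_of_index_two (index_zpowers_eq_two (by omega) hs hs1 hβ),
      h.notMem_zpowers hs hs1, hγ]
  obtain ⟨t, ht, htγ⟩ := Finset.mem_image.1 (mem_zpowers_iff_mem_range_orderOf.1 hmem)
  rw [Finset.mem_range, hβ] at ht
  exact ⟨genX n s, β, h, t, by omega, by rw [htγ, mul_inv_cancel_left]⟩

theorem hasShortProductOneSubseq_of_lt_card (hn : 4 ≤ n) (hs : s ^ 2 ≡ 1 [ZMOD n])
    (hs1 : ¬ s ≡ 1 [ZMOD n]) {S : Multiset (Gns n s)} (hS : n < S.card) :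
    HasShortProductOneSubseq S := by
  have := finite_Gns (s := s) (by omega : 0 < n)
  have hY := card_zpowers_genY hs
  by_contra hno
  refine hS.not_ge ((card_le_of_forall_productOneFree (index_zpowers_genY hs hs1)
    (fun T hTS hT => ?_) (not_commute_genX_genY hs hs1) (hn.trans_eq hY.symm)).trans_eq hY)
  by_contra hT1
  obtain ⟨U, hUT, hU⟩ := hasShortProductOneSubseq_of_not_productOneFree
    ((hT.trans hY).trans_le (le_exponent (by omega) hs)) hT1
  exact hno ⟨U, hUT.trans hTS, hU⟩

theorem eta_Gns (hn : 4 ≤ n) (hs : s ^ 2 ≡ 1 [ZMOD n]) (hs1 : ¬ s ≡ 1 [ZMOD n]) :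
    eta (Gns n s) = n + 1 := by
  refine IsLeast.csInf_eq ⟨⟨n.succ_pos, fun S => hasShortProductOneSubseq_of_lt_card hn hs hs1⟩,
    fun ℓ ⟨_, hℓ⟩ => ?_⟩
  by_contra! hlt
  have hfree := (isPresentedBy_genX (by omega) hs hs1 (orderOf_genY hs)).productOneFree hs hs1 0
  refine hfree.not_hasShortProductOneSubseq (hℓ _ ?_)
  rw [Multiset.card_add, Multiset.card_replicate, Multiset.card_singleton]
  omega

end Extremal

end ZeroSum

theorem theorem1p3_general (n : ℕ) (hn : 4 ≤ n) (s : ℤ) (hs : s ^ 2 ≡ 1 [ZMOD n])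
    (hs1 : ¬ s ≡ 1 [ZMOD n]) :
    ZeroSum.eta (ZeroSum.Gns n s) = n + 1 ∧
    ∀ S : Multiset (ZeroSum.Gns n s), Multiset.card S = n →
      (¬ ZeroSum.HasShortProductOneSubseq S ↔
        ∃ α β : ZeroSum.Gns n s, ZeroSum.IsPresentedBy n s α β ∧
          ∃ t : ℕ, t ≤ n - 1 ∧
            S = Multiset.replicate (n - 1) β + {α * β ^ t}) := by
  refine ⟨ZeroSum.eta_Gns hn hs hs1, fun S hcard => ⟨fun hS => ?_, ?_⟩⟩
  · have hle : S.card ≤ Monoid.exponent (ZeroSum.Gns n s) :=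
      hcard.trans_le (ZeroSum.le_exponent (by omega) hs)
    have hfree : ZeroSum.ProductOneFree S := by
      by_contra h
      exact hS (ZeroSum.hasShortProductOneSubseq_of_not_productOneFree hle h)
    exact hfree.exists_isPresentedBy hn hs hs1 hcard
  · rintro ⟨α, β, h, t, -, rfl⟩
    exact (h.productOneFree hs hs1 t).not_hasShortProductOneSubseq

theorem theorem1p3 (n : ℕ) (hn : 8 ≤ n) (s : ℤ) (hs : s ^ 2 ≡ 1 [ZMOD n])
    (hs1 : ¬ s ≡ 1 [ZMOD n]) (hs2 : ¬ s ≡ -1 [ZMOD n]) :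
    ZeroSum.eta (ZeroSum.Gns n s) = n + 1 ∧
    ∀ S : Multiset (ZeroSum.Gns n s), Multiset.card S = n →
      (¬ ZeroSum.HasShortProductOneSubseq S ↔
        ∃ α β : ZeroSum.Gns n s, ZeroSum.IsPresentedBy n s α β ∧
          ∃ t : ℕ, t ≤ n - 1 ∧
            S = Multiset.replicate (n - 1) β + {α * β ^ t}) :=
  theorem1p3_general n (by omega) s hs hs1
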